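/- **Setting.** Manifolds, metrics, tensor fields and connections are smooth; manifolds are Hausdorff, second countable and without boundary. For a $1$-form $\eta$ we use $d\eta(X,Y)=X(\eta(Y))-Y(\eta(X))-\eta([X,Y])$, and for a $2$-form $d\omega(X,Y,Z)=\mathfrak S_{XYZ}\big(X(\omega(Y,Z))-\omega([X,Y],Z)\big)$, with $\mathfrak S$ the cyclic sum. An *almost contact structure* on $M$ is a triple $(\varphi,\xi,\eta)$ of a $(1,1)$-tensor field, a vector field and a $1$-form with $\varphi^2=-I+\eta\otimes\xi$ and $\eta(\xi)=1$; a Riemannian metric $g$ is compatible with it if $g(\varphi X,\varphi Y)=g(X,Y)-\eta(X)\eta(Y)$. An *almost $3$-contact metric manifold* $(M,\varphi_i,\xi_i,\eta_i,g)$, $i=1,2,3$, is a Riemannian manifold $(M,g)$ of dimension $4n+3$ ($n\ge 0$) with three almost contact structures compatible with $g$ such that, for every even permutation $(i,j,k)$ of $(1,2,3)$, $$\varphi_k=\varphi_i\varphi_j-\eta_j\otimes\xi_i=-\varphi_j\varphi_i+\eta_i\otimes\xi_j,\quad \xi_k=\varphi_i\xi_j=-\varphi_j\xi_i,\quad \eta_k=\eta_i\circ\varphi_j=-\eta_j\circ\varphi_i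 .$$ Let $\mathcal H=\bigcap_i\ker\eta_i$ and $\mathcal V=\langle\xi_1,\xi_2,\xi_3\rangle$, so that $TM=\mathcal H\oplus\mathcal V$. The *associated sphere* $\Sigma_M$ consists of the structures $\varphi=\sum_i a_i\varphi_i$, with $\xi=\sum_i a_i\xi_i$, $\eta=\sum_i a_i\eta_i$, for constants $a\in S^2$. For $\varphi\in\Sigma_M$ let $\Phi(X,Y)=g(X,\varphi Y)$ and $$N_\varphi(X,Y)=[\varphi X,\varphi Y]+\varphi^2[X,Y]-\varphi[\varphi X,Y]-\varphi[X,\varphi Y]+d\eta(X,Y)\,\xi,\qquad N_\varphi(X,Y,Z)=g(N_\varphi(X,Y),Z).$$ For a linear connection $\nabla$ let $T(X,Y)=\nabla_XY-\nabla_YX-[X,Y]$ and $T(X,Y,Z)=g(T(X,Y),Z)$. It is called *$\varphi$-compatible* if $\nabla g=0$, $T(X,Y,Z)$ is a $3$-form, $\nabla$ preserves $\mathcal H$ and $\mathcal V$ (i.e. $\nabla_XY\in\Gamma(\mathcal H)$ for $Y\in\Gamma(\mathcal H)$, and likewise for $\mathcal V$, for every vector field $X$), and $(\nabla_X\varphi)Y=0$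 for all $X,Y\in\Gamma(\mathcal H)$. **Theorem (Existence of $\varphi$-compatible connections).** Let $(M,\varphi_i,\xi_i,\eta_i,g)$ be an almost $3$-contact metric manifold and $\varphi\in\Sigma_M$. Then $M$ admits a $\varphi$-compatible connection if and only if the following conditions are satisfied: 1. $N_\varphi$ is skew-symmetric on $\mathcal H$, i.e. $N_\varphi(X,Y,Z)$ is totally skew-symmetric in $X,Y,Z\in\Gamma(\mathcal H)$; 2. $(\mathcal L_{\xi_i}g)(X,Y)=0$ for every $X,Y\in\Gamma(\mathcal H)$ and $i=1,2,3$; 3. $(\mathcal L_Xg)(\xi_i,\xi_j)=0$ for every $X\in\Gamma(\mathcal H)$ and $i,j=1,2,3$. Moreover, the torsion of any $\varphi$-compatible connection satisfies, for $X,Y,Z\in\Gamma(\mathcal H)$ and $i,j=1,2,3$, $$T(X,Y,Z)=N_\varphi(X,Y,Z)-d\Phi(\varphi X,\varphi Y,\varphi Z),\qquad T(X,Y,\xi_i)=d\eta_i(X,Y),\qquad T(X,\xi_i,\xi_j)=-g([\xi_i,\xi_j],X).$$ -/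

import Mathlib

open Bundle VectorField
open scoped Manifold ContDiff

noncomputable section

namespace AlmostContact

variable {E : Type*} [NormedAddCommGroup E] [NormedSpace ℝ E]
  {H : Type*} [TopologicalSpace H] (I : ModelWithCorners ℝ E H)
  (M : Type*) [TopologicalSpace M] [ChartedSpace H M]

/-- A (rough) vector field on `M`. -/
abbrev VField : Type _ := (x : M) → TangentSpace I x

/-- A (rough) field of endomorphisms of the tangent spaces, i.e. a `(1,1)`-tensor field. -/
abbrev EndField : Type _ := (x : M) → TangentSpace I x →L[ℝ] TangentSpace I x

/-- A (rough) differential `1`-form. -/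
abbrev OneForm : Type _ := (x : M) → TangentSpace I x →L[ℝ] ℝ

/-- A (rough) field of subspaces of the tangent spaces. -/
abbrev Distribution : Type _ := (x : M) → Submodule ℝ (TangentSpace I x)

/-- A triple `(φ, ξ, η)`: a `(1,1)`-tensor field, a vector field and a `1`-form, not yet subject
to any condition. -/
structure Triple where
  phi : EndField I M
  xi : VField I M
  eta : OneForm I M

variable {I M}

/-- The function `Y(f)`, the derivative of `f` in the direction of the vector field `Y`. -/
def dirDeriv (Y : VField I M) (f : M → ℝ) : M → ℝ := fun x ↦ mvfderiv I f x (Y x)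

/-- The vector field `φ Y`. -/
def EndField.app (phi : EndField I M) (Y : VField I M) : VField I M := fun x ↦ phi x (Y x)

/-- The function `η(Y)`. -/
def OneForm.app (eta : OneForm I M) (Y : VField I M) : M → ℝ := fun x ↦ eta x (Y x)

/-- The exterior derivative of a `1`-form,
`dη(X, Y) = X(η(Y)) - Y(η(X)) - η([X, Y])`. -/
def extDerivOne (eta : OneForm I M) (X Y : VField I M) : M → ℝ :=
  dirDeriv X (eta.app Y) - dirDeriv Y (eta.app X) - eta.app (mlieBracket I X Y)

/-- The exterior derivative of a `2`-form, given as a function of two vector fields,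
`dω(X, Y, Z) = X(ω(Y, Z)) + Y(ω(Z, X)) + Z(ω(X, Y)) - ω([X, Y], Z) - ω([Y, Z], X) - ω([Z, X], Y)`. -/
def extDerivTwo (om : VField I M → VField I M → M → ℝ) (X Y Z : VField I M) : M → ℝ :=
  dirDeriv X (om Y Z) + dirDeriv Y (om Z X) + dirDeriv Z (om X Y)
    - om (mlieBracket I X Y) Z - om (mlieBracket I Y Z) X - om (mlieBracket I Z X) Y

/-- The tensor field `N_φ = [φ, φ] + dη ⊗ ξ`, where
`[φ, φ](X, Y) = [φX, φY] + φ²[X, Y] - φ[φX, Y] - φ[X, φY]`. -/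
def Triple.nijenhuis (s : Triple I M) (X Y : VField I M) : VField I M :=
  mlieBracket I (s.phi.app X) (s.phi.app Y) + s.phi.app (s.phi.app (mlieBracket I X Y))
    - s.phi.app (mlieBracket I (s.phi.app X) Y) - s.phi.app (mlieBracket I X (s.phi.app Y))
    + fun x ↦ extDerivOne s.eta X Y x • s.xi x

section Smooth

/-- Smoothness of a vector field on `M`. -/
def IsSmoothVField [IsManifold I 1 M] (Y : VField I M) : Prop :=
  ContMDiff I I.tangent ∞ (fun x ↦ (⟨x, Y x⟩ : TangentBundle I M))

/-- `Y ∈ Γ(D)`: `Y` is a smooth vector field on `M` with values in the distribution `D`. -/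
def IsSectionOf [IsManifold I 1 M] (D : Distribution I M) (Y : VField I M) : Prop :=
  IsSmoothVField Y ∧ ∀ x, Y x ∈ D x

/-- `(φ, ξ, η)` is a (smooth) almost contact structure:
`φ² = -I + η ⊗ ξ` and `η(ξ) = 1`. -/
structure Triple.IsAlmostContact [IsManifold I 1 M] (s : Triple I M) : Prop where
  smooth_phi : ContMDiff I (I.prod 𝓘(ℝ, E →L[ℝ] E)) ∞
    (fun x ↦ TotalSpace.mk' (E →L[ℝ] E)
      (E := fun x : M ↦ TangentSpace I x →L[ℝ] TangentSpace I x) x (s.phi x))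
  smooth_xi : IsSmoothVField s.xi
  smooth_eta : ContMDiff I (I.prod 𝓘(ℝ, E →L[ℝ] ℝ)) ∞
    (fun x ↦ TotalSpace.mk' (E →L[ℝ] ℝ)
      (E := fun x : M ↦ TangentSpace I x →L[ℝ] ℝ) x (s.eta x))
  phi_phi : ∀ (x : M) (v : TangentSpace I x),
    s.phi x (s.phi x v) = -v + s.eta x v • s.xi x
  eta_xi : ∀ x : M, s.eta x (s.xi x) = 1

end Smooth

section Metric

variable [RiemannianBundle (fun x : M ↦ TangentSpace I x)]

/-- The function `g(Y, Z)`. -/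
def metric (Y Z : VField I M) : M → ℝ := fun x ↦ inner ℝ (Y x) (Z x)

/-- The Lie derivative of the metric,
`(L_X g)(Y, Z) = X(g(Y, Z)) - g([X, Y], Z) - g(Y, [X, Z])`. -/
def lieDerivMetric (X Y Z : VField I M) : M → ℝ :=
  dirDeriv X (metric Y Z) - metric (mlieBracket I X Y) Z - metric Y (mlieBracket I X Z)

/-- The fundamental `2`-form `Φ(X, Y) = g(X, φY)`. -/
def Triple.fundamentalForm (s : Triple I M) (X Y : VField I M) : M → ℝ :=
  metric X (s.phi.app Y)

/-- The `(0,3)`-tensor field `N_φ(X, Y, Z) = g(N_φ(X, Y), Z)`. -/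
def Triple.nijenhuis₃ (s : Triple I M) (X Y Z : VField I M) : M → ℝ :=
  metric (s.nijenhuis X Y) Z

/-- `N_φ` is skew-symmetric on the distribution `D`: the restriction to `D` of the
`(0,3)`-tensor field `N_φ(X, Y, Z)` is totally skew-symmetric. -/
def Triple.NijenhuisSkewOn [IsManifold I 1 M] (s : Triple I M) (D : Distribution I M) : Prop :=
  ∀ X Y Z : VField I M, IsSectionOf D X → IsSectionOf D Y → IsSectionOf D Z →
    s.nijenhuis₃ Y X Z = -s.nijenhuis₃ X Y Z ∧ s.nijenhuis₃ X Z Y = -s.nijenhuis₃ X Y Z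

variable (I M) in
/-- An almost `3`-contact metric structure `(φ_i, ξ_i, η_i, g)`, `i = 1, 2, 3`, on the manifold `M`
with Riemannian metric `g`. The index set is `Fin 3`; the even permutations are
`(i, i + 1, i + 2)`. -/
structure ThreeContactMetric [IsManifold I 1 M] where
  str : Fin 3 → Triple I M
  isAlmostContact : ∀ i, (str i).IsAlmostContact
  compatible : ∀ (i : Fin 3) (x : M) (v w : TangentSpace I x),
    inner ℝ ((str i).phi x v) ((str i).phi x w)
      = inner ℝ v w - (str i).eta x v * (str i).eta x w
  phi_eq : ∀ (i : Fin 3) (x : M) (v : TangentSpace I x),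
    (str (i + 2)).phi x v
      = (str i).phi x ((str (i + 1)).phi x v) - (str (i + 1)).eta x v • (str i).xi x
  phi_eq' : ∀ (i : Fin 3) (x : M) (v : TangentSpace I x),
    (str (i + 2)).phi x v
      = -(str (i + 1)).phi x ((str i).phi x v) + (str i).eta x v • (str (i + 1)).xi x
  xi_eq : ∀ (i : Fin 3) (x : M), (str (i + 2)).xi x = (str i).phi x ((str (i + 1)).xi x)
  xi_eq' : ∀ (i : Fin 3) (x : M), (str (i + 2)).xi x = -(str (i + 1)).phi x ((str i).xi x)
  eta_eq : ∀ (i : Fin 3) (x : M) (v : TangentSpace I x),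
    (str (i + 2)).eta x v = (str i).eta x ((str (i + 1)).phi x v)
  eta_eq' : ∀ (i : Fin 3) (x : M) (v : TangentSpace I x),
    (str (i + 2)).eta x v = -(str (i + 1)).eta x ((str i).phi x v)

namespace ThreeContactMetric

variable [IsManifold I 1 M]

/-- The Reeb vector field `ξ_i`. -/
def xi (S : ThreeContactMetric I M) (i : Fin 3) : VField I M := (S.str i).xi

/-- The `1`-form `η_i`. -/
def eta (S : ThreeContactMetric I M) (i : Fin 3) : OneForm I M := (S.str i).eta

/-- The horizontal distribution, the intersection of the kernels of `η_1, η_2, η_3`. -/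
def horizontal (S : ThreeContactMetric I M) : Distribution I M :=
  fun x ↦ ⨅ i, (S.eta i x).ker

/-- The vertical distribution, spanned by `ξ_1, ξ_2, ξ_3`. -/
def vertical (S : ThreeContactMetric I M) : Distribution I M :=
  fun x ↦ Submodule.span ℝ (Set.range fun i ↦ S.xi i x)

/-- The triple `(φ_a, ξ_a, η_a) = ∑ i, a_i (φ_i, ξ_i, η_i)`. -/
def combination (S : ThreeContactMetric I M) (a : Fin 3 → ℝ) : Triple I M where
  phi := fun x ↦ ∑ i, a i • (S.str i).phi x
  xi := fun x ↦ ∑ i, a i • (S.str i).xi x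
  eta := fun x ↦ ∑ i, a i • (S.str i).eta x

/-- The associated sphere `Σ_M`, whose elements are recorded together with their Reeb vector field
and dual `1`-form. -/
def associatedSphere (S : ThreeContactMetric I M) : Set (Triple I M) :=
  {s | ∃ a : Fin 3 → ℝ, ∑ i, a i ^ 2 = 1 ∧ s = S.combination a}

end ThreeContactMetric

end Metric

section Connection

variable [FiniteDimensional ℝ E] [CompleteSpace E] [IsManifold I ∞ M]
  [RiemannianBundle (fun x : M ↦ TangentSpace I x)]

/-- The vector field `∇_X Y`. -/
def nabla (cov : CovariantDerivative I E (fun x : M ↦ TangentSpace I x)) (X Y : VField I M) :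
    VField I M := fun x ↦ cov Y x (X x)

/-- The `(0,3)`-torsion `T(X, Y, Z) = g(T(X, Y), Z)` with
`T(X, Y) = ∇_X Y - ∇_Y X - [X, Y]`. -/
def torsion₃ (cov : CovariantDerivative I E (fun x : M ↦ TangentSpace I x))
    (X Y Z : VField I M) : M → ℝ :=
  fun x ↦ inner ℝ (cov.torsion x (X x) (Y x)) (Z x)

/-- The connection is metric, `∇g = 0`: `X(g(Y, Z)) = g(∇_X Y, Z) + g(Y, ∇_X Z)`. -/
def IsMetricConnection (cov : CovariantDerivative I E (fun x : M ↦ TangentSpace I x)) : Prop :=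
  ∀ X Y Z : VField I M, IsSmoothVField X → IsSmoothVField Y → IsSmoothVField Z →
    dirDeriv X (metric Y Z) = metric (nabla cov X Y) Z + metric Y (nabla cov X Z)

/-- The connection has skew torsion: `T(X, Y, Z)` is a `3`-form. -/
def HasSkewTorsion (cov : CovariantDerivative I E (fun x : M ↦ TangentSpace I x)) : Prop :=
  ∀ (x : M) (u v w : TangentSpace I x),
    inner ℝ (cov.torsion x v u) w = -inner ℝ (cov.torsion x u v) w ∧
    inner ℝ (cov.torsion x u w) v = -inner ℝ (cov.torsion x u v) w

/-- The connection preserves the distribution `D`: `∇_X Y ∈ Γ(D)` whenever `Y ∈ Γ(D)`. -/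
def Preserves (cov : CovariantDerivative I E (fun x : M ↦ TangentSpace I x))
    (D : Distribution I M) : Prop :=
  ∀ X Y : VField I M, IsSmoothVField X → IsSectionOf D Y → IsSectionOf D (nabla cov X Y)

/-- A `φ`-compatible connection: a smooth linear connection which is metric, has skew torsion,
preserves the splitting of the tangent bundle into horizontal and vertical part, and satisfies
`(∇_X φ) Y = ∇_X (φY) - φ(∇_X Y) = 0` for all horizontal `X`, `Y`. -/
structure IsCompatibleConnection (S : ThreeContactMetric I M) (s : Triple I M)
    (cov : CovariantDerivative I E (fun x : M ↦ TangentSpace I x)) : Prop where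
  smooth : CovariantDerivative.ContMDiffCovariantDerivative cov ∞
  metric : IsMetricConnection cov
  skew : HasSkewTorsion cov
  preserves_horizontal : Preserves cov S.horizontal
  preserves_vertical : Preserves cov S.vertical
  parallel : ∀ X Y : VField I M, IsSectionOf S.horizontal X → IsSectionOf S.horizontal Y →
    nabla cov X (s.phi.app Y) - s.phi.app (nabla cov X Y) = 0

end Connection

end AlmostContact

end

noncomputable section

set_option linter.unusedSectionVars false

namespace AlmostContact

section SmoothTools

variable {E : Type*} [NormedAddCommGroup E] [NormedSpace ℝ E] [FiniteDimensional ℝ E]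
  {H : Type*} [TopologicalSpace H] {I : ModelWithCorners ℝ E H}
  {M : Type*} [TopologicalSpace M] [ChartedSpace H M] [IsManifold I ∞ M]

omit [FiniteDimensional ℝ E] in
theorem IsSmoothVField.mdifferentiableAt {X : VField I M} (hX : IsSmoothVField X) (x : M) :
    MDiffAt (T% X) x :=
  (hX x).mdifferentiableAt (by simp)

/-- Every germ of a standard local extension of a tangent vector is the germ of a smooth vector
field on `M`. -/
theorem exists_isSmoothVField_eventuallyEq_extend [T2Space M] (x : M) (v : TangentSpace I x) :
    ∃ X : VField I M, IsSmoothVField X ∧ ∀ᶠ y in nhds x, X y = FiberBundle.extend E v y := by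
  obtain ⟨s, hs, hsm⟩ := FiberBundle.exists_contMDiffOn_extend (k := ∞) I E v
  obtain ⟨f, -, hf⟩ := (SmoothBumpFunction.nhds_basis_tsupport (I := I) x).mem_iff.mp
    (interior_mem_nhds.mpr hs)
  refine ⟨(f : M → ℝ) • FiberBundle.extend E v, ?_, ?_⟩
  · exact ContMDiffOn.smul_section_of_tsupport f.contMDiff.contMDiffOn isOpen_interior hf
      (hsm.mono interior_subset)
  · filter_upwards [f.eventuallyEq_one] with y hy
    simp [hy]

/-- Every tangent vector is the value of a smooth vector field. -/
theorem exists_isSmoothVField_apply_eq [T2Space M] (x : M) (v : TangentSpace I x) :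
    ∃ X : VField I M, IsSmoothVField X ∧ X x = v := by
  obtain ⟨X, hX, h⟩ := exists_isSmoothVField_eventuallyEq_extend x v
  exact ⟨X, hX, by simpa using h.self_of_nhds⟩

theorem exists_isSmoothVField_eventuallyEq_symm [T2Space M] (x : M) (e : E) :
    ∃ X : VField I M, IsSmoothVField X ∧ ∀ᶠ y in nhds x,
      X y = (trivializationAt E (TangentSpace I : M → Type _) x).symm y e := by
  set t := trivializationAt E (TangentSpace I : M → Type _) x with ht
  have hx : x ∈ t.baseSet := FiberBundle.mem_baseSet_trivializationAt' x
  obtain ⟨X, hX, hXe⟩ := exists_isSmoothVField_eventuallyEq_extend x (t.symm x e)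
  refine ⟨X, hX, hXe.mono fun y hy ↦ ?_⟩
  rw [hy, FiberBundle.extend, ← ht, t.apply_mk_symm hx]

omit [FiniteDimensional ℝ E] [IsManifold I ∞ M] in
theorem contMDiffAt_clm_of_apply {F G : Type*} [NormedAddCommGroup F] [NormedSpace ℝ F]
    [NormedAddCommGroup G] [NormedSpace ℝ G] [FiniteDimensional ℝ F] {n : ℕ∞ω}
    {f : M → F →L[ℝ] G} {x : M}
    (h : ∀ v, ContMDiffAt I 𝓘(ℝ, G) n (fun y ↦ f y v) x) :
    ContMDiffAt I 𝓘(ℝ, F →L[ℝ] G) n f x := by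
  have hd := (Module.finrank_fin_fun ℝ (n := Module.finrank ℝ F)).symm
  let e₁ := ContinuousLinearEquiv.ofFinrankEq hd
  let e₂ := (e₁.arrowCongr (1 : G ≃L[ℝ] G)).trans
    (ContinuousLinearEquiv.piRing (Fin (Module.finrank ℝ F)))
  have h₂ : ContMDiffAt I 𝓘(ℝ, Fin (Module.finrank ℝ F) → G) n (fun y ↦ e₂ (f y)) x :=
    contMDiffAt_pi_space.mpr fun i ↦ h _
  have h₃ := (e₂.symm.contDiff (n := n)).contDiffAt.comp_contMDiffAt h₂
  simpa [Function.comp_def] using h₃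

/-- A field of endomorphisms is smooth if it maps smooth vector fields to smooth ones. -/
theorem contMDiffAt_endField_of_apply [T2Space M] {A : EndField I M} {x : M}
    (h : ∀ X : VField I M, IsSmoothVField X → ContMDiffAt I I.tangent ∞ (T% (A.app X)) x) :
    ContMDiffAt I (I.prod 𝓘(ℝ, E →L[ℝ] E)) ∞
      (fun x ↦ TotalSpace.mk' (E →L[ℝ] E)
        (E := fun x : M ↦ TangentSpace I x →L[ℝ] TangentSpace I x) x (A x)) x := by
  rw [contMDiffAt_hom_bundle]
  refine ⟨contMDiffAt_id, contMDiffAt_clm_of_apply fun e ↦ ?_⟩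
  set t := trivializationAt E (TangentSpace I : M → Type _) x with ht
  have hx : x ∈ t.baseSet := FiberBundle.mem_baseSet_trivializationAt' x
  obtain ⟨X, hX, hXe⟩ := exists_isSmoothVField_eventuallyEq_symm (I := I) x e
  have hAX := (contMDiffAt_section _).mp (h X hX)
  refine hAX.congr_of_eventuallyEq ?_
  filter_upwards [hXe, t.open_baseSet.mem_nhds hx] with y hy hyt
  rw [ContinuousLinearMap.inCoordinates_eq hyt hyt]
  simp [EndField.app, hy, ← ht]

omit [FiniteDimensional ℝ E] in
theorem IsSmoothVField.contMDiff_dirDeriv {X : VField I M} (hX : IsSmoothVField X) {f : M → ℝ}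
    (hf : ContMDiff I 𝓘(ℝ, ℝ) ∞ f) : ContMDiff I 𝓘(ℝ, ℝ) ∞ (dirDeriv X f) :=
  (contMDiff_snd_tangentBundle_modelSpace ℝ 𝓘(ℝ, ℝ)).comp
    ((hf.contMDiff_tangentMap (m := ∞) (by simp)).comp hX)

omit [FiniteDimensional ℝ E] in
theorem IsSmoothVField.mlieBracket [CompleteSpace E] {X Y : VField I M} (hX : IsSmoothVField X)
    (hY : IsSmoothVField Y) : IsSmoothVField (mlieBracket I X Y) := fun x ↦
  have : IsManifold I (minSmoothness ℝ 2) M := by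
    rw [minSmoothness_of_isRCLikeNormedField]; infer_instance
  have : IsManifold I ((⊤ : ℕ∞) + 1 : ℕ∞ω) M := by
    simpa using (inferInstance : IsManifold I ∞ M)
  ContMDiffAt.mlieBracket_vectorField (m := ⊤) (n := ⊤) (hX x) (hY x) (by simp)

variable [RiemannianBundle (fun x : M ↦ TangentSpace I x)]
  [IsContMDiffRiemannianBundle I ∞ E (fun x : M ↦ TangentSpace I x)]

omit [FiniteDimensional ℝ E] in
theorem IsSmoothVField.contMDiff_metric {X Y : VField I M} (hX : IsSmoothVField X)
    (hY : IsSmoothVField Y) : ContMDiff I 𝓘(ℝ, ℝ) ∞ (metric X Y) :=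
  ContMDiff.inner_bundle (IB := I) (F := E) (E := fun x : M ↦ TangentSpace I x) hX hY

/-- A vector field is smooth if its inner products with smooth vector fields are smooth. -/
theorem contMDiffAt_of_metric [T2Space M] {W : VField I M} {x : M}
    (h : ∀ Z : VField I M, IsSmoothVField Z → ContMDiffAt I 𝓘(ℝ, ℝ) ∞ (metric W Z) x) :
    ContMDiffAt I I.tangent ∞ (T% W) x := by
  have : CompleteSpace E := FiniteDimensional.complete ℝ E
  set t := trivializationAt E (TangentSpace I : M → Type _) x with ht
  have hx : x ∈ t.baseSet := FiberBundle.mem_baseSet_trivializationAt' x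
  choose X hX hXe using fun e : E ↦
    exists_isSmoothVField_eventuallyEq_symm (I := I) x e
  have hXe' : ∀ e, ∀ᶠ y in nhds x, X e y = t.symmL ℝ y e := by
    intro e
    filter_upwards [hXe e, t.open_baseSet.mem_nhds hx] with y hy hyt
    rw [hy, t.symmL_apply hyt]
  let β : M → E →L[ℝ] ℝ := fun y ↦ (innerSL ℝ (W y)).comp (t.symmL ℝ y)
  let Γ : M → E →L[ℝ] E →L[ℝ] ℝ := fun y ↦
    ((innerSL ℝ (E := TangentSpace I y)).bilinearComp (t.symmL ℝ y) (t.symmL ℝ y))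
  have hβ : ContMDiffAt I 𝓘(ℝ, E →L[ℝ] ℝ) ∞ β x := by
    refine contMDiffAt_clm_of_apply fun e ↦ (h (X e) (hX e)).congr_of_eventuallyEq ?_
    filter_upwards [hXe' e] with y hy
    simp [β, metric, hy]
  have hΓ : ContMDiffAt I 𝓘(ℝ, E →L[ℝ] E →L[ℝ] ℝ) ∞ Γ x := by
    refine contMDiffAt_clm_of_apply fun e ↦ contMDiffAt_clm_of_apply fun e' ↦
      ((hX e).contMDiff_metric (hX e') x).congr_of_eventuallyEq ?_
    filter_upwards [hXe' e, hXe' e'] with y hy hy'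
    simp [Γ, metric, hy, hy']
  have hinj : ∀ y ∈ t.baseSet, Function.Injective (Γ y) := by
    intro y hy
    rw [injective_iff_map_eq_zero]
    intro e he
    have h0 : inner ℝ (t.symmL ℝ y e) (t.symmL ℝ y e) = (0 : ℝ) := congr($he e)
    have h1 := inner_self_eq_zero.mp h0
    rw [t.symmL_apply hy] at h1
    have h2 := t.apply_mk_symm hy e
    rw [h1] at h2
    have h3 : t ⟨y, 0⟩ = (y, 0) := t.zeroSection ℝ hy
    exact congrArg Prod.snd (h2.symm.trans h3)
  have hfin : Module.finrank ℝ E = Module.finrank ℝ (E →L[ℝ] ℝ) := by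
    rw [← (LinearMap.toContinuousLinearMap (𝕜 := ℝ) (E := E) (F' := ℝ)).finrank_eq]
    exact Subspace.dual_finrank_eq.symm
  have hequiv : ∀ y ∈ t.baseSet, ∃ e : E ≃L[ℝ] (E →L[ℝ] ℝ), (e : E →L[ℝ] E →L[ℝ] ℝ) = Γ y := by
    intro y hy
    refine ⟨(LinearEquiv.ofInjectiveOfFinrankEq (Γ y).toLinearMap (hinj y hy)
      hfin).toContinuousLinearEquiv, ?_⟩
    rfl
  have hinv : ContMDiffAt I 𝓘(ℝ, (E →L[ℝ] ℝ) →L[ℝ] E) ∞ (fun y ↦ (Γ y).inverse) x := by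
    obtain ⟨e, he⟩ := hequiv x hx
    have h1 : ContDiffAt ℝ ∞ ContinuousLinearMap.inverse (Γ x) :=
      he ▸ contDiffAt_map_inverse e
    exact h1.comp_contMDiffAt hΓ
  rw [contMDiffAt_section]
  refine (hinv.clm_apply hβ).congr_of_eventuallyEq ?_
  filter_upwards [t.open_baseSet.mem_nhds hx] with y hy
  obtain ⟨e, he⟩ := hequiv y hy
  have : β y = e (t ⟨y, W y⟩).2 := by
    ext v
    change _ = (e : E →L[ℝ] E →L[ℝ] ℝ) _ v
    rw [he]
    simp [β, Γ, t.symmL_apply hy, t.symm_apply_apply_mk hy]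
  rw [this, ← he]
  simp [ht]

end SmoothTools

end AlmostContact

namespace AlmostContact

section LeviCivita

variable {E : Type*} [NormedAddCommGroup E] [NormedSpace ℝ E] [FiniteDimensional ℝ E]
  [CompleteSpace E]
  {H : Type*} [TopologicalSpace H] {I : ModelWithCorners ℝ E H}
  {M : Type*} [TopologicalSpace M] [ChartedSpace H M] [IsManifold I ∞ M]
  [RiemannianBundle (fun x : M ↦ TangentSpace I x)]
  [IsContMDiffRiemannianBundle I ∞ E (fun x : M ↦ TangentSpace I x)]

/-- The right-hand side of the Koszul formula for `2 g(∇_X Y, Z)`. -/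
def koszul (X Y Z : VField I M) : M → ℝ :=
  dirDeriv X (metric Y Z) + dirDeriv Y (metric Z X) - dirDeriv Z (metric X Y)
    + metric (mlieBracket I X Y) Z - metric (mlieBracket I X Z) Y - metric (mlieBracket I Y Z) X

omit [FiniteDimensional ℝ E] [CompleteSpace E] in
theorem mdifferentiableAt_metric {X Y : VField I M} {x : M} (hX : MDiffAt (T% X) x)
    (hY : MDiffAt (T% Y) x) : MDiffAt (metric X Y) x :=
  MDifferentiableAt.inner_bundle (IB := I) (F := E) (E := fun x : M ↦ TangentSpace I x) hX hY

omit [FiniteDimensional ℝ E] [CompleteSpace E] [IsManifold I ∞ M]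
  [IsContMDiffRiemannianBundle I ∞ E (fun x : M ↦ TangentSpace I x)] in
theorem metric_comm (X Y : VField I M) : metric X Y = metric Y X :=
  funext fun _ ↦ real_inner_comm _ _

theorem dirDeriv_metric_add {W X Y Z : VField I M} {x : M} (hX : MDiffAt (T% X) x)
    (hY : MDiffAt (T% Y) x) (hZ : MDiffAt (T% Z) x) :
    dirDeriv W (metric (X + Y) Z) x = dirDeriv W (metric X Z) x + dirDeriv W (metric Y Z) x := by
  have : metric (X + Y) Z = metric X Z + metric Y Z := by
    ext y; simp [metric, inner_add_left]
  rw [this, dirDeriv, mvfderiv_add (mdifferentiableAt_metric hX hZ)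
    (mdifferentiableAt_metric hY hZ)]
  rfl

theorem dirDeriv_metric_smul {W X Z : VField I M} {f : M → ℝ} {x : M} (hf : MDiffAt f x)
    (hX : MDiffAt (T% X) x) (hZ : MDiffAt (T% Z) x) :
    dirDeriv W (metric (f • X) Z) x
      = dirDeriv W f x * metric X Z x + f x * dirDeriv W (metric X Z) x := by
  have : metric (f • X) Z = f * metric X Z := by
    ext y; simp [metric, inner_smul_left]
  rw [this, dirDeriv, mvfderiv_mul hf (mdifferentiableAt_metric hX hZ)]
  simp [dirDeriv]; ring

theorem koszul_add_left {X X' Y Z : VField I M} {x : M} (hX : MDiffAt (T% X) x)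
    (hX' : MDiffAt (T% X') x) (hY : MDiffAt (T% Y) x) (hZ : MDiffAt (T% Z) x) :
    koszul (X + X') Y Z x = koszul X Y Z x + koszul X' Y Z x := by
  simp only [koszul, Pi.add_apply, Pi.sub_apply, metric_comm Z]
  rw [dirDeriv_metric_add hX hX' hZ, dirDeriv_metric_add hX hX' hY]
  simp only [metric, dirDeriv, mlieBracket_add_left hX hX', Pi.add_apply, map_add,
    inner_add_left, inner_add_right]
  ring

theorem koszul_add_middle {X Y Y' Z : VField I M} {x : M} (hX : MDiffAt (T% X) x)
    (hY : MDiffAt (T% Y) x) (hY' : MDiffAt (T% Y') x) (hZ : MDiffAt (T% Z) x) :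
    koszul X (Y + Y') Z x = koszul X Y Z x + koszul X Y' Z x := by
  simp only [koszul, Pi.add_apply, Pi.sub_apply, metric_comm X]
  rw [dirDeriv_metric_add hY hY' hZ, dirDeriv_metric_add hY hY' hX]
  simp only [metric, dirDeriv, mlieBracket_add_left hY hY', mlieBracket_add_right hY hY',
    Pi.add_apply, map_add, inner_add_left, inner_add_right]
  ring

theorem koszul_add_right {X Y Z Z' : VField I M} {x : M} (hX : MDiffAt (T% X) x)
    (hY : MDiffAt (T% Y) x) (hZ : MDiffAt (T% Z) x) (hZ' : MDiffAt (T% Z') x) :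
    koszul X Y (Z + Z') x = koszul X Y Z x + koszul X Y Z' x := by
  simp only [koszul, Pi.add_apply, Pi.sub_apply, metric_comm Y]
  rw [dirDeriv_metric_add hZ hZ' hY, dirDeriv_metric_add hZ hZ' hX]
  simp only [metric, dirDeriv, mlieBracket_add_right hZ hZ',
    Pi.add_apply, map_add, inner_add_left, inner_add_right]
  ring

theorem koszul_smul_left {f : M → ℝ} {X Y Z : VField I M} {x : M} (hf : MDiffAt f x)
    (hX : MDiffAt (T% X) x) (hY : MDiffAt (T% Y) x) (hZ : MDiffAt (T% Z) x) :
    koszul (f • X) Y Z x = f x * koszul X Y Z x := by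
  simp only [koszul, Pi.add_apply, Pi.sub_apply, metric_comm Z]
  rw [dirDeriv_metric_smul hf hX hZ, dirDeriv_metric_smul hf hX hY]
  simp only [metric, dirDeriv, mlieBracket_smul_left hf hX, Pi.smul_apply', map_smul,
    inner_add_left, inner_smul_left, inner_smul_right, real_inner_comm (Y x) (X x), smul_eq_mul,
    RCLike.conj_to_real]
  ring

theorem koszul_smul_right {f : M → ℝ} {X Y Z : VField I M} {x : M} (hf : MDiffAt f x)
    (hX : MDiffAt (T% X) x) (hY : MDiffAt (T% Y) x) (hZ : MDiffAt (T% Z) x) :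
    koszul X Y (f • Z) x = f x * koszul X Y Z x := by
  simp only [koszul, Pi.add_apply, Pi.sub_apply, metric_comm Y]
  rw [dirDeriv_metric_smul hf hZ hY, dirDeriv_metric_smul hf hZ hX]
  simp only [metric, dirDeriv, mlieBracket_smul_right hf hZ, Pi.smul_apply', map_smul,
    inner_add_left, inner_smul_left, inner_smul_right, smul_eq_mul, RCLike.conj_to_real]
  ring

theorem koszul_smul_middle {f : M → ℝ} {X Y Z : VField I M} {x : M} (hf : MDiffAt f x)
    (hX : MDiffAt (T% X) x) (hY : MDiffAt (T% Y) x) (hZ : MDiffAt (T% Z) x) :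
    koszul X (f • Y) Z x = f x * koszul X Y Z x + 2 * (dirDeriv X f x * metric Y Z x) := by
  simp only [koszul, Pi.add_apply, Pi.sub_apply, metric_comm X]
  rw [dirDeriv_metric_smul hf hY hZ, dirDeriv_metric_smul hf hY hX]
  simp only [metric, dirDeriv, mlieBracket_smul_left hf hY, mlieBracket_smul_right hf hY,
    Pi.smul_apply', map_smul, smul_eq_mul, RCLike.conj_to_real,
    inner_add_left, inner_smul_left, inner_smul_right]
  ring

theorem exists_clm_inner_eq {V : Type*} [NormedAddCommGroup V] [InnerProductSpace ℝ V]
    [FiniteDimensional ℝ V] (b : V →L[ℝ] V →L[ℝ] ℝ) :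
    ∃ A : V →L[ℝ] V, ∀ v w, inner ℝ (A v) w = b v w := by
  have : CompleteSpace V := FiniteDimensional.complete ℝ V
  refine ⟨LinearMap.toContinuousLinearMap
    { toFun := fun v ↦ (InnerProductSpace.toDual ℝ V).symm (b v)
      map_add' := by simp
      map_smul' := by simp }, fun v w ↦ ?_⟩
  simp

theorem exists_inner_eq_koszul {Y : VField I M} {x : M} (hY : MDiffAt (T% Y) x) :
    ∃ A : TangentSpace I x →L[ℝ] TangentSpace I x, ∀ X Z : VField I M,
      MDiffAt (T% X) x → MDiffAt (T% Z) x → inner ℝ (A (X x)) (Z x) = koszul X Y Z x / 2 := by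
  have h₁ : ∀ Z : VField I M, MDiffAt (T% Z) x →
      TensorialAt I E (fun X ↦ koszul X Y Z x / 2) x := fun Z hZ ↦
    { smul := fun hf hX ↦ by
        simp only [koszul_smul_left hf hX hY hZ, smul_eq_mul]; ring
      add := fun hX hX' ↦ by simp only [koszul_add_left hX hX' hY hZ]; ring }
  have h₂ : ∀ X : VField I M, MDiffAt (T% X) x →
      TensorialAt I E (fun Z ↦ koszul X Y Z x / 2) x := fun X hX ↦
    { smul := fun hf hZ ↦ by
        simp only [koszul_smul_right hf hX hY hZ, smul_eq_mul]; ring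
      add := fun hZ hZ' ↦ by simp only [koszul_add_right hX hY hZ hZ']; ring }
  have : FiniteDimensional ℝ (TangentSpace I x) := inferInstanceAs (FiniteDimensional ℝ E)
  obtain ⟨A, hA⟩ := exists_clm_inner_eq (TensorialAt.mkHom₂ _ x h₁ h₂)
  exact ⟨A, fun X Z hX hZ ↦ by rw [hA, TensorialAt.mkHom₂_apply h₁ h₂ hX hZ]⟩

open Classical in
variable (I M) in
/-- The Levi-Civita connection. -/
def leviCivita : CovariantDerivative I E (fun x : M ↦ TangentSpace I x) where
  toFun Y x := if hY : MDiffAt (T% Y) x then (exists_inner_eq_koszul hY).choose else 0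
  isCovariantDerivativeOnUniv :=
    { add := by
        intro Y Y' x hY hY' _
        have hs : MDiffAt (T% (Y + Y')) x := mdifferentiableAt_add_section hY hY'
        simp only [dif_pos hY, dif_pos hY', dif_pos hs]
        ext v
        refine ext_inner_right ℝ fun w ↦ ?_
        have hv := FiberBundle.mdifferentiableAt_extend I E v
        have hw := FiberBundle.mdifferentiableAt_extend I E w
        have h := (exists_inner_eq_koszul hY).choose_spec _ _ hv hw
        have h' := (exists_inner_eq_koszul hY').choose_spec _ _ hv hw
        have h'' := (exists_inner_eq_koszul hs).choose_spec _ _ hv hw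
        rw [koszul_add_middle hv hY hY' hw] at h''
        simp only [FiberBundle.extend_apply_self] at h h' h''
        rw [add_apply, inner_add_left, h, h', h'']
        ring
      leibniz := by
        intro Y f x hY hf _
        have hs : MDiffAt (T% (f • Y)) x := hf.smul_section hY
        simp only [dif_pos hY, dif_pos hs]
        ext v
        refine ext_inner_right ℝ fun w ↦ ?_
        have hv := FiberBundle.mdifferentiableAt_extend I E v
        have hw := FiberBundle.mdifferentiableAt_extend I E w
        have h := (exists_inner_eq_koszul hY).choose_spec _ _ hv hw
        have h'' := (exists_inner_eq_koszul hs).choose_spec _ _ hv hw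
        rw [koszul_smul_middle hf hv hY hw] at h''
        simp only [FiberBundle.extend_apply_self, metric, dirDeriv] at h h''
        simp only [add_apply, smul_apply,
          ContinuousLinearMap.smulRight_apply, inner_add_left, inner_smul_left, h, h'',
          RCLike.conj_to_real]
        ring }

theorem inner_leviCivita {X Y Z : VField I M} {x : M} (hX : MDiffAt (T% X) x)
    (hY : MDiffAt (T% Y) x) (hZ : MDiffAt (T% Z) x) :
    inner ℝ (leviCivita I M Y x (X x)) (Z x) = koszul X Y Z x / 2 := by
  have h : leviCivita I M Y x = (exists_inner_eq_koszul hY).choose := dif_pos hY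
  rw [h]
  exact (exists_inner_eq_koszul hY).choose_spec _ _ hX hZ

theorem leviCivita_metric {X Y Z : VField I M} {x : M} (hX : MDiffAt (T% X) x)
    (hY : MDiffAt (T% Y) x) (hZ : MDiffAt (T% Z) x) :
    dirDeriv X (metric Y Z) x
      = inner ℝ (leviCivita I M Y x (X x)) (Z x) + inner ℝ (Y x) (leviCivita I M Z x (X x)) := by
  rw [inner_leviCivita hX hY hZ, (real_inner_comm _ _).trans (inner_leviCivita hX hZ hY)]
  simp only [koszul, Pi.add_apply, Pi.sub_apply, metric_comm Z, metric_comm Y X,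
    mlieBracket_swap (V := Z) (W := Y)]
  simp only [metric, Pi.neg_apply, inner_neg_left]
  ring

theorem leviCivita_sub {X Y : VField I M} {x : M} (hX : MDiffAt (T% X) x)
    (hY : MDiffAt (T% Y) x) :
    leviCivita I M Y x (X x) - leviCivita I M X x (Y x) = mlieBracket I X Y x := by
  refine ext_inner_right ℝ fun w ↦ ?_
  have hw := FiberBundle.mdifferentiableAt_extend I E w
  have h := inner_leviCivita hX hY hw
  have h' := inner_leviCivita hY hX hw
  simp only [koszul, Pi.add_apply, Pi.sub_apply, metric_comm (FiberBundle.extend E w),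
    metric_comm Y X, mlieBracket_swap (V := Y) (W := X)] at h h'
  simp only [metric, Pi.neg_apply, inner_neg_left, FiberBundle.extend_apply_self] at h h'
  rw [inner_sub_left, h, h']
  ring

omit [FiniteDimensional ℝ E] in
theorem contMDiff_koszul {X Y Z : VField I M} (hX : IsSmoothVField X)
    (hY : IsSmoothVField Y) (hZ : IsSmoothVField Z) : ContMDiff I 𝓘(ℝ, ℝ) ∞ (koszul X Y Z) :=
  (((((hX.contMDiff_dirDeriv (hY.contMDiff_metric hZ)).add
    (hY.contMDiff_dirDeriv (hZ.contMDiff_metric hX))).sub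
    (hZ.contMDiff_dirDeriv (hX.contMDiff_metric hY))).add
    ((hX.mlieBracket hY).contMDiff_metric hZ)).sub
    ((hX.mlieBracket hZ).contMDiff_metric hY)).sub
    ((hY.mlieBracket hZ).contMDiff_metric hX)

/-- A covariant derivative is smooth if the functions `g(∇_X Y, Z)` are smooth. -/
theorem contMDiffCovariantDerivative_of_metric [T2Space M]
    {cov : CovariantDerivative I E (fun x : M ↦ TangentSpace I x)}
    (h : ∀ X Y Z : VField I M, IsSmoothVField X → IsSmoothVField Y → IsSmoothVField Z →
      ContMDiff I 𝓘(ℝ, ℝ) ∞ (metric (nabla cov X Y) Z)) :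
    CovariantDerivative.ContMDiffCovariantDerivative cov ∞ where
  contMDiff :=
    { contMDiff := fun {Y} hY ↦ by
        have hY' : IsSmoothVField Y := (contMDiffOn_univ.mp hY).of_le (by simp)
        rw [contMDiffOn_univ]
        exact fun x ↦ contMDiffAt_endField_of_apply fun X hX ↦
          contMDiffAt_of_metric fun Z hZ ↦ h X Y Z hX hY' hZ x }

omit [CompleteSpace E] [RiemannianBundle (fun x : M ↦ TangentSpace I x)]
  [IsContMDiffRiemannianBundle I ∞ E (fun x : M ↦ TangentSpace I x)] in
theorem IsSmoothVField.nabla {cov : CovariantDerivative I E (fun x : M ↦ TangentSpace I x)}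
    (hcov : CovariantDerivative.ContMDiffCovariantDerivative cov ∞) {X Y : VField I M}
    (hX : IsSmoothVField X) (hY : IsSmoothVField Y) : IsSmoothVField (nabla cov X Y) := by
  have h := contMDiffOn_univ.mp (hcov.contMDiff.contMDiff (σ := Y) (contMDiffOn_univ.mpr
    (ContMDiff.of_le hY (by simp))))
  exact ContMDiff.clm_bundle_apply (F₁ := E) (F₂ := E) h hX

theorem contMDiffCovariantDerivative_leviCivita [T2Space M] :
    CovariantDerivative.ContMDiffCovariantDerivative (leviCivita I M) ∞ :=
  contMDiffCovariantDerivative_of_metric fun X Y Z hX hY hZ ↦ by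
    have : metric (nabla (leviCivita I M) X Y) Z = fun x ↦ koszul X Y Z x / 2 :=
      funext fun x ↦ inner_leviCivita (hX.mdifferentiableAt x) (hY.mdifferentiableAt x)
        (hZ.mdifferentiableAt x)
    rw [this]
    exact (contMDiff_koszul hX hY hZ).div_const 2

end LeviCivita

end AlmostContact

namespace AlmostContact

namespace ThreeContactMetric

variable {E : Type*} [NormedAddCommGroup E] [NormedSpace ℝ E]
  {H : Type*} [TopologicalSpace H] {I : ModelWithCorners ℝ E H}
  {M : Type*} [TopologicalSpace M] [ChartedSpace H M] [IsManifold I 1 M]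
  [RiemannianBundle (fun x : M ↦ TangentSpace I x)]
  (S : ThreeContactMetric I M)

theorem mem_horizontal {x : M} {v : TangentSpace I x} :
    v ∈ S.horizontal x ↔ ∀ i, S.eta i x v = 0 := by
  simp [horizontal]

theorem phi_xi_self (i : Fin 3) (x : M) : (S.str i).phi x (S.xi i x) = 0 := by
  have h := (S.isAlmostContact i).phi_phi x
  have hη := (S.isAlmostContact i).eta_xi x
  set w := (S.str i).phi x (S.xi i x) with hw
  have h1 : (S.str i).phi x w = 0 := by
    rw [hw, xi, h, hη]; simp
  have h2 : w = (S.str i).eta x w • S.xi i x := by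
    have := h w
    rw [h1, map_zero] at this
    exact (neg_add_eq_zero.mp this.symm)
  have h3 : (S.str i).eta x w • w = 0 := by
    rw [← h1]
    conv_rhs => rw [h2]
    rw [map_smul, ← hw]
  rcases smul_eq_zero.mp h3 with h4 | h4
  · rw [h2, h4, zero_smul]
  · exact h4

theorem eta_phi_self (i : Fin 3) (x : M) (v : TangentSpace I x) :
    S.eta i x ((S.str i).phi x v) = 0 := by
  have h := (S.isAlmostContact i).phi_phi x
  have h1 := h ((S.str i).phi x v)
  rw [h v, map_add, map_smul, map_neg] at h1
  have h2 := S.phi_xi_self i x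
  rw [xi] at h2
  rw [h2, smul_zero, add_zero, left_eq_add] at h1
  rcases smul_eq_zero.mp h1 with h3 | h3
  · exact h3
  · have := (S.isAlmostContact i).eta_xi x
    rw [h3, map_zero] at this
    exact absurd this zero_ne_one

theorem inner_xi (i : Fin 3) (x : M) (v : TangentSpace I x) :
    inner ℝ v (S.xi i x) = S.eta i x v := by
  have h := S.compatible i x v (S.xi i x)
  rw [phi_xi_self, inner_zero_right] at h
  have := (S.isAlmostContact i).eta_xi x
  rw [xi, this] at h
  rw [xi, eta]
  linarith

theorem inner_phi (i : Fin 3) (x : M) (v w : TangentSpace I x) :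
    inner ℝ ((S.str i).phi x v) w = -inner ℝ v ((S.str i).phi x w) := by
  have h := S.compatible i x v ((S.str i).phi x w)
  have h1 := S.eta_phi_self i x w
  have h2 := S.eta_phi_self i x v
  have h3 := S.inner_xi i x ((S.str i).phi x v)
  rw [xi] at h3
  rw [eta] at h1 h2 h3
  rw [(S.isAlmostContact i).phi_phi, h1, inner_add_right, inner_smul_right, h3, h2,
    inner_neg_right] at h
  linarith

theorem eta_xi (i j : Fin 3) (x : M) : S.eta i x (S.xi j x) = if i = j then 1 else 0 := by
  have h1 (i : Fin 3) : S.eta i x (S.xi (i + 2) x) = 0 := by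
    rw [xi, S.xi_eq i x, eta_phi_self]
  have h2 (i : Fin 3) : S.eta (i + 1) x (S.xi (i + 2) x) = 0 := by
    rw [xi, S.xi_eq' i x, map_neg, eta_phi_self, neg_zero]
  have h3 (i : Fin 3) : S.eta i x (S.xi i x) = 1 := (S.isAlmostContact i).eta_xi x
  have a0 := h1 0
  have a1 := h1 1
  have a2 := h1 2
  have b0 := h2 0
  have b1 := h2 1
  have b2 := h2 2
  simp only [Fin.isValue, zero_add, Fin.reduceAdd] at a0 a1 a2 b0 b1 b2
  fin_cases i <;> fin_cases j <;> simp [h3, a0, a1, a2, b0, b1, b2]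

theorem eta_phi (i j : Fin 3) (x : M) {v : TangentSpace I x} (hv : v ∈ S.horizontal x) :
    S.eta i x ((S.str j).phi x v) = 0 := by
  have h0 := S.mem_horizontal.mp hv
  have h1 := fun i ↦ S.eta_eq i x v
  have h2 := fun i ↦ S.eta_eq' i x v
  have h3 := fun i ↦ S.eta_phi_self i x v
  simp only [eta] at h0 h3 ⊢
  have a0 := h1 0
  have a1 := h1 1
  have a2 := h1 2
  have b0 := h2 0
  have b1 := h2 1
  have b2 := h2 2
  simp only [Fin.isValue, zero_add, Fin.reduceAdd, h0] at a0 a1 a2 b0 b1 b2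
  fin_cases i <;> fin_cases j <;> simp [h3, ← a0, ← a1, ← a2] <;> linarith

theorem combination_phi_apply (a : Fin 3 → ℝ) (x : M) (v : TangentSpace I x) :
    (S.combination a).phi x v = ∑ i, a i • (S.str i).phi x v := by
  simp [combination]

theorem inner_combination_phi (a : Fin 3 → ℝ) (x : M) (v w : TangentSpace I x) :
    inner ℝ ((S.combination a).phi x v) w = -inner ℝ v ((S.combination a).phi x w) := by
  simp [combination_phi_apply, sum_inner, inner_sum, inner_smul_left, inner_smul_right, inner_phi]

theorem combination_phi_mem (a : Fin 3 → ℝ) {x : M} {v : TangentSpace I x}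
    (hv : v ∈ S.horizontal x) : (S.combination a).phi x v ∈ S.horizontal x := by
  simp [mem_horizontal, combination_phi_apply, S.eta_phi _ _ x hv]

theorem combination_phi_phi {a : Fin 3 → ℝ} (ha : ∑ i, a i ^ 2 = 1) {x : M} {v : TangentSpace I x}
    (hv : v ∈ S.horizontal x) :
    (S.combination a).phi x ((S.combination a).phi x v) = -v := by
  have h0 := S.mem_horizontal.mp hv
  have h1 := fun i ↦ S.phi_eq i x v
  have h2 := fun i ↦ S.phi_eq' i x v
  have h3 := fun i ↦ (S.isAlmostContact i).phi_phi x v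
  simp only [eta] at h0
  simp only [h0, zero_smul, sub_zero, add_zero] at h1 h2 h3
  have a0 := h1 0
  have a1 := h1 1
  have a2 := h1 2
  have b0 := h2 0
  have b1 := h2 1
  have b2 := h2 2
  simp only [Fin.isValue, zero_add, Fin.reduceAdd] at a0 a1 a2 b0 b1 b2
  have hv' : v = (a 0 ^ 2 + a 1 ^ 2 + a 2 ^ 2) • v := by
    rw [← Fin.sum_univ_three (fun i ↦ a i ^ 2), ha, one_smul]
  rw [eq_neg_iff_add_eq_zero] at b0 b1 b2
  conv_rhs => rw [hv']
  simp only [combination_phi_apply, Fin.sum_univ_three, map_add, map_smul, h3, ← a0, ← a1, ← a2,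
    eq_neg_of_add_eq_zero_right b0, eq_neg_of_add_eq_zero_right b1,
    eq_neg_of_add_eq_zero_right b2]
  module

end ThreeContactMetric

end AlmostContact

namespace AlmostContact

namespace ThreeContactMetric

section Splitting

variable {E : Type*} [NormedAddCommGroup E] [NormedSpace ℝ E]
  {H : Type*} [TopologicalSpace H] {I : ModelWithCorners ℝ E H}
  {M : Type*} [TopologicalSpace M] [ChartedSpace H M] [IsManifold I ∞ M]
  [RiemannianBundle (fun x : M ↦ TangentSpace I x)]
  (S : ThreeContactMetric I M)

theorem isSmoothVField_xi (i : Fin 3) : IsSmoothVField (S.xi i) :=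
  (S.isAlmostContact i).smooth_xi

/-- The orthogonal projection onto the horizontal distribution. -/
def proj : EndField I M := fun x ↦
  ContinuousLinearMap.id ℝ (TangentSpace I x) - ∑ i, (S.eta i x).smulRight (S.xi i x)

theorem proj_apply (x : M) (v : TangentSpace I x) :
    S.proj x v = v - ∑ i, S.eta i x v • S.xi i x := by
  simp [proj]

theorem proj_mem (x : M) (v : TangentSpace I x) : S.proj x v ∈ S.horizontal x := by
  rw [mem_horizontal]
  intro i
  simp [proj_apply, eta_xi]

theorem proj_eq_self {x : M} {v : TangentSpace I x} (hv : v ∈ S.horizontal x) :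
    S.proj x v = v := by
  simp [proj_apply, S.mem_horizontal.mp hv]

theorem proj_xi (i : Fin 3) (x : M) : S.proj x (S.xi i x) = 0 := by
  simp [proj_apply, eta_xi]

theorem inner_xi_of_mem (i : Fin 3) {x : M} {v : TangentSpace I x} (hv : v ∈ S.horizontal x) :
    inner ℝ v (S.xi i x) = 0 := by
  rw [inner_xi, S.mem_horizontal.mp hv]

theorem inner_eq_zero_of_mem {x : M} {v w : TangentSpace I x} (hv : v ∈ S.vertical x)
    (hw : w ∈ S.horizontal x) : inner ℝ v w = 0 := by
  induction hv using Submodule.span_induction with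
  | mem v hv =>
    obtain ⟨i, rfl⟩ := hv
    rw [real_inner_comm, S.inner_xi_of_mem i hw]
  | zero => simp
  | add v v' _ _ h h' => rw [inner_add_left, h, h', add_zero]
  | smul c v _ h => rw [inner_smul_left, h, mul_zero]

theorem xi_mem_vertical (i : Fin 3) (x : M) : S.xi i x ∈ S.vertical x :=
  Submodule.subset_span ⟨i, rfl⟩

theorem mem_vertical_of_inner_eq_zero {x : M} {v : TangentSpace I x}
    (h : ∀ w ∈ S.horizontal x, inner ℝ v w = 0) : v ∈ S.vertical x := by
  have hv : v = S.proj x v + ∑ i, S.eta i x v • S.xi i x := by rw [proj_apply]; abel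
  have h0 : S.proj x v = 0 := by
    have h1 (i : Fin 3) : inner ℝ (S.eta i x v • S.xi i x) (S.proj x v) = 0 := by
      rw [inner_smul_left, real_inner_comm, S.inner_xi_of_mem i (S.proj_mem x v), mul_zero]
    have h2 := congrArg (fun u ↦ inner ℝ u (S.proj x v)) hv
    simp only [h _ (S.proj_mem x v), inner_add_left, sum_inner, h1, Finset.sum_const_zero,
      add_zero] at h2
    exact inner_self_eq_zero.mp h2.symm
  rw [hv, h0, zero_add]
  exact Submodule.sum_mem _ fun i _ ↦ Submodule.smul_mem _ _ (S.xi_mem_vertical i x)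

variable [IsContMDiffRiemannianBundle I ∞ E (fun x : M ↦ TangentSpace I x)]

theorem isSmoothVField_proj {X : VField I M} (hX : IsSmoothVField X) :
    IsSmoothVField (S.proj.app X) := by
  have h : S.proj.app X = X - fun x ↦ ∑ i, metric X (S.xi i) x • S.xi i x := by
    ext x
    simp [EndField.app, proj_apply, metric, inner_xi]
  rw [h]
  exact ContMDiff.sub_section (V := fun x : M ↦ TangentSpace I x) hX
    (ContMDiff.sum_section fun i _ ↦ ContMDiff.smul_section
      (hX.contMDiff_metric (S.isSmoothVField_xi i)) (S.isSmoothVField_xi i))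

theorem isSectionOf_proj {X : VField I M} (hX : IsSmoothVField X) :
    IsSectionOf S.horizontal (S.proj.app X) :=
  ⟨S.isSmoothVField_proj hX, fun x ↦ S.proj_mem x _⟩

theorem exists_isSectionOf_horizontal [FiniteDimensional ℝ E] [T2Space M] {x : M}
    {v : TangentSpace I x}
    (hv : v ∈ S.horizontal x) : ∃ X, IsSectionOf S.horizontal X ∧ X x = v := by
  obtain ⟨X, hX, hXv⟩ := exists_isSmoothVField_apply_eq x v
  exact ⟨_, S.isSectionOf_proj hX, by rw [EndField.app, hXv, S.proj_eq_self hv]⟩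

end Splitting

section Hermitian

variable {E : Type*} [NormedAddCommGroup E] [NormedSpace ℝ E]
  {H : Type*} [TopologicalSpace H] {I : ModelWithCorners ℝ E H}
  {M : Type*} [TopologicalSpace M] [ChartedSpace H M] [IsManifold I ∞ M]
  [RiemannianBundle (fun x : M ↦ TangentSpace I x)]
  (S : ThreeContactMetric I M)

/-- The triple `s` restricts to an almost Hermitian structure on the horizontal distribution, and
its Reeb vector field is vertical. -/
structure IsHermitian (s : Triple I M) : Prop where
  smooth_phi : ContMDiff I (I.prod 𝓘(ℝ, E →L[ℝ] E)) ∞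
    (fun x ↦ TotalSpace.mk' (E →L[ℝ] E)
      (E := fun x : M ↦ TangentSpace I x →L[ℝ] TangentSpace I x) x (s.phi x))
  inner_phi (x : M) (v w : TangentSpace I x) :
    inner ℝ (s.phi x v) w = -inner ℝ v (s.phi x w)
  phi_mem {x : M} {v : TangentSpace I x} : v ∈ S.horizontal x → s.phi x v ∈ S.horizontal x
  phi_phi {x : M} {v : TangentSpace I x} : v ∈ S.horizontal x → s.phi x (s.phi x v) = -v
  xi_mem (x : M) : s.xi x ∈ S.vertical x

theorem isHermitian_of_mem {s : Triple I M} (hs : s ∈ S.associatedSphere) : S.IsHermitian s := by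
  obtain ⟨a, ha, rfl⟩ := hs
  exact
    { smooth_phi := ContMDiff.sum_section (s := Finset.univ) fun i _ ↦
        ContMDiff.const_smul_section (a := a i) (S.isAlmostContact i).smooth_phi
      inner_phi := S.inner_combination_phi a
      phi_mem := S.combination_phi_mem a
      phi_phi := S.combination_phi_phi ha
      xi_mem := fun x ↦ Submodule.sum_mem (t := Finset.univ) _ fun i _ ↦
        Submodule.smul_mem _ (a i) (S.xi_mem_vertical i x) }

variable {S} {s : Triple I M}

theorem IsHermitian.isSmoothVField (hs : S.IsHermitian s) {X : VField I M}
    (hX : IsSmoothVField X) : IsSmoothVField (s.phi.app X) :=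
  ContMDiff.clm_bundle_apply (F₁ := E) (F₂ := E) hs.smooth_phi hX

theorem IsHermitian.mdifferentiableAt (hs : S.IsHermitian s) {X : VField I M} {x : M}
    (hX : MDiffAt (T% X) x) : MDiffAt (T% (s.phi.app X)) x :=
  MDifferentiableAt.clm_bundle_apply (F₁ := E) (F₂ := E)
    ((hs.smooth_phi x).mdifferentiableAt (by simp)) hX

theorem IsHermitian.isSectionOf (hs : S.IsHermitian s) {X : VField I M}
    (hX : IsSectionOf S.horizontal X) : IsSectionOf S.horizontal (s.phi.app X) :=
  ⟨hs.isSmoothVField hX.1, fun x ↦ hs.phi_mem (hX.2 x)⟩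

theorem IsHermitian.phi_app_phi_app (hs : S.IsHermitian s) {X : VField I M}
    (hX : IsSectionOf S.horizontal X) (x : M) : s.phi.app (s.phi.app X) x = -X x :=
  hs.phi_phi (hX.2 x)

theorem IsHermitian.inner_phi_phi (hs : S.IsHermitian s) {x : M} (v : TangentSpace I x)
    {w : TangentSpace I x} (hw : w ∈ S.horizontal x) :
    inner ℝ (s.phi x v) (s.phi x w) = inner ℝ v w := by
  rw [hs.inner_phi, hs.phi_phi hw, inner_neg_right, neg_neg]

theorem IsHermitian.nijenhuis₃_apply (hs : S.IsHermitian s) {Z : VField I M}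
    (hZ : IsSectionOf S.horizontal Z) (X Y : VField I M) (x : M) :
    s.nijenhuis₃ X Y Z x
      = inner ℝ (mlieBracket I (s.phi.app X) (s.phi.app Y) x) (Z x)
        - inner ℝ (mlieBracket I X Y x) (Z x)
        + inner ℝ (mlieBracket I (s.phi.app X) Y x) (s.phi.app Z x)
        + inner ℝ (mlieBracket I X (s.phi.app Y) x) (s.phi.app Z x) := by
  simp only [Triple.nijenhuis₃, metric, Triple.nijenhuis, EndField.app, Pi.add_apply, Pi.sub_apply,
    inner_add_left, inner_sub_left, inner_smul_left]
  rw [S.inner_eq_zero_of_mem (hs.xi_mem x) (hZ.2 x)]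
  simp only [hs.inner_phi, hs.phi_phi (hZ.2 x), inner_neg_right]
  ring

end Hermitian

end ThreeContactMetric

section Compatible

variable {E : Type*} [NormedAddCommGroup E] [NormedSpace ℝ E] [FiniteDimensional ℝ E]
  [CompleteSpace E]
  {H : Type*} [TopologicalSpace H] {I : ModelWithCorners ℝ E H}
  {M : Type*} [TopologicalSpace M] [ChartedSpace H M] [IsManifold I ∞ M]
  [RiemannianBundle (fun x : M ↦ TangentSpace I x)]
  {S : ThreeContactMetric I M} {s : Triple I M}
  {cov : CovariantDerivative I E (fun x : M ↦ TangentSpace I x)}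

theorem mlieBracket_eq_sub_torsion {X Y : VField I M} {x : M} (hX : MDiffAt (T% X) x)
    (hY : MDiffAt (T% Y) x) :
    mlieBracket I X Y x = cov Y x (X x) - cov X x (Y x) - cov.torsion x (X x) (Y x) := by
  rw [cov.torsion_apply hX hY]
  abel

namespace IsCompatibleConnection

variable (hc : IsCompatibleConnection S s cov) (hs : S.IsHermitian s)
include hc

theorem dirDeriv_metric {X Y Z : VField I M} (hX : IsSmoothVField X) (hY : IsSmoothVField Y)
    (hZ : IsSmoothVField Z) (x : M) : dirDeriv X (AlmostContact.metric Y Z) x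
      = inner ℝ (cov Y x (X x)) (Z x) + inner ℝ (Y x) (cov Z x (X x)) :=
  congrFun (hc.metric X Y Z hX hY hZ) x

theorem cov_phi {X Y : VField I M} (hX : IsSectionOf S.horizontal X)
    (hY : IsSectionOf S.horizontal Y) (x : M) :
    cov (s.phi.app Y) x (X x) = s.phi x (cov Y x (X x)) :=
  sub_eq_zero.mp (congrFun (hc.parallel X Y hX hY) x)

theorem inner_cov_xi {X Y : VField I M} (hX : IsSmoothVField X)
    (hY : IsSectionOf S.horizontal Y) (i : Fin 3) (x : M) :
    inner ℝ (cov Y x (X x)) (S.xi i x) = 0 :=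
  S.inner_xi_of_mem i ((hc.preserves_horizontal X Y hX hY).2 x)

theorem inner_cov_of_mem {X Y : VField I M} (hX : IsSmoothVField X)
    (hY : IsSectionOf S.horizontal Y) (i : Fin 3) (x : M) :
    inner ℝ (cov (S.xi i) x (X x)) (Y x) = 0 :=
  S.inner_eq_zero_of_mem ((hc.preserves_vertical X (S.xi i) hX
    ⟨S.isSmoothVField_xi i, S.xi_mem_vertical i⟩).2 x) (hY.2 x)

include hs

theorem nijenhuis₃_eq {X Y Z : VField I M} (hX : IsSectionOf S.horizontal X)
    (hY : IsSectionOf S.horizontal Y) (hZ : IsSectionOf S.horizontal Z) :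
    s.nijenhuis₃ X Y Z = torsion₃ cov X Y Z - torsion₃ cov (s.phi.app X) (s.phi.app Y) Z
      - torsion₃ cov (s.phi.app X) Y (s.phi.app Z)
      - torsion₃ cov X (s.phi.app Y) (s.phi.app Z) := by
  ext x
  have hX' := hs.isSectionOf hX
  have hY' := hs.isSectionOf hY
  rw [hs.nijenhuis₃_apply hZ, mlieBracket_eq_sub_torsion (cov := cov) (hX.1.mdifferentiableAt x)
      (hY.1.mdifferentiableAt x), mlieBracket_eq_sub_torsion (cov := cov)
      (hX.1.mdifferentiableAt x) (hY'.1.mdifferentiableAt x),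
    mlieBracket_eq_sub_torsion (cov := cov) (hX'.1.mdifferentiableAt x)
      (hY.1.mdifferentiableAt x), mlieBracket_eq_sub_torsion (cov := cov)
      (hX'.1.mdifferentiableAt x) (hY'.1.mdifferentiableAt x),
    hc.cov_phi hX' hY, hc.cov_phi hX hY, hc.cov_phi hY' hX, hc.cov_phi hY hX]
  simp only [torsion₃, Pi.sub_apply, inner_sub_left]
  simp only [EndField.app, hs.inner_phi_phi _ (hZ.2 x)]
  rw [hs.inner_phi x _ (Z x), hs.inner_phi x _ (Z x)]
  ring

theorem extDerivTwo_eq {X Y Z : VField I M} (hX : IsSectionOf S.horizontal X)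
    (hY : IsSectionOf S.horizontal Y) (hZ : IsSectionOf S.horizontal Z) :
    extDerivTwo s.fundamentalForm X Y Z = torsion₃ cov X Y (s.phi.app Z)
      + torsion₃ cov Y Z (s.phi.app X) + torsion₃ cov Z X (s.phi.app Y) := by
  ext x
  have hX' := hs.isSectionOf hX
  have hY' := hs.isSectionOf hY
  have hZ' := hs.isSectionOf hZ
  simp only [extDerivTwo, Triple.fundamentalForm, Pi.add_apply, Pi.sub_apply,
    hc.dirDeriv_metric hX.1 hY.1 hZ'.1, hc.dirDeriv_metric hY.1 hZ.1 hX'.1,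
    hc.dirDeriv_metric hZ.1 hX.1 hY'.1, hc.cov_phi hX hZ, hc.cov_phi hY hX, hc.cov_phi hZ hY]
  simp only [AlmostContact.metric, torsion₃,
    mlieBracket_eq_sub_torsion (cov := cov) (hX.1.mdifferentiableAt x) (hY.1.mdifferentiableAt x),
    mlieBracket_eq_sub_torsion (cov := cov) (hY.1.mdifferentiableAt x) (hZ.1.mdifferentiableAt x),
    mlieBracket_eq_sub_torsion (cov := cov) (hZ.1.mdifferentiableAt x) (hX.1.mdifferentiableAt x),
    inner_sub_left, EndField.app]
  have h (v w : TangentSpace I x) : inner ℝ v (s.phi x w) = -inner ℝ w (s.phi x v) := by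
    rw [real_inner_comm, hs.inner_phi]
  rw [h (X x) (cov Y x (Z x)), h (Y x) (cov Z x (X x)), h (Z x) (cov X x (Y x))]
  ring

theorem nijenhuisSkewOn : s.NijenhuisSkewOn S.horizontal := by
  intro X Y Z hX hY hZ
  have h := hc.skew
  rw [hc.nijenhuis₃_eq hs hX hY hZ, hc.nijenhuis₃_eq hs hY hX hZ, hc.nijenhuis₃_eq hs hX hZ hY]
  constructor
  · ext x
    simp only [torsion₃, Pi.sub_apply, Pi.neg_apply]
    linarith [(h x (X x) (Y x) (Z x)).1, (h x (s.phi.app X x) (s.phi.app Y x) (Z x)).1,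
      (h x (s.phi.app X x) (Y x) (s.phi.app Z x)).1, (h x (X x) (s.phi.app Y x) (s.phi.app Z x)).1]
  · ext x
    simp only [torsion₃, Pi.sub_apply, Pi.neg_apply]
    linarith [(h x (X x) (Y x) (Z x)).2, (h x (s.phi.app X x) (s.phi.app Y x) (Z x)).2,
      (h x (s.phi.app X x) (Y x) (s.phi.app Z x)).2, (h x (X x) (s.phi.app Y x) (s.phi.app Z x)).2]

theorem torsion₃_horizontal {X Y Z : VField I M} (hX : IsSectionOf S.horizontal X)
    (hY : IsSectionOf S.horizontal Y) (hZ : IsSectionOf S.horizontal Z) :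
    torsion₃ cov X Y Z = s.nijenhuis₃ X Y Z
      - extDerivTwo s.fundamentalForm (s.phi.app X) (s.phi.app Y) (s.phi.app Z) := by
  rw [hc.nijenhuis₃_eq hs hX hY hZ, hc.extDerivTwo_eq hs (hs.isSectionOf hX) (hs.isSectionOf hY)
    (hs.isSectionOf hZ)]
  ext x
  have h := hc.skew x
  simp only [torsion₃, Pi.sub_apply, Pi.add_apply, hs.phi_app_phi_app hX, hs.phi_app_phi_app hY,
    hs.phi_app_phi_app hZ, inner_neg_right]
  linarith [(h (s.phi.app Y x) (X x) (s.phi.app Z x)).2, (h (s.phi.app X x) (Y x) (s.phi.app Z x)).1,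
    (h (s.phi.app Y x) (X x) (s.phi.app Z x)).1, (h (s.phi.app X x) (Y x) (s.phi.app Z x)).2,
    (h (s.phi.app Z x) (s.phi.app X x) (Y x)).1]

omit hs

theorem torsion₃_xi {X Y : VField I M} (hX : IsSectionOf S.horizontal X)
    (hY : IsSectionOf S.horizontal Y) (i : Fin 3) :
    torsion₃ cov X Y (S.xi i) = extDerivOne (S.eta i) X Y := by
  ext x
  have h0 {Z : VField I M} (hZ : IsSectionOf S.horizontal Z) : (S.eta i).app Z = 0 :=
    funext fun y ↦ S.mem_horizontal.mp (hZ.2 y) i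
  simp only [extDerivOne, h0 hX, h0 hY, Pi.sub_apply, dirDeriv, mvfderiv_zero]
  simp only [OneForm.app, ← S.inner_xi,
    mlieBracket_eq_sub_torsion (cov := cov) (hX.1.mdifferentiableAt x) (hY.1.mdifferentiableAt x),
    inner_sub_left, hc.inner_cov_xi hX.1 hY, hc.inner_cov_xi hY.1 hX]
  simp [torsion₃]

theorem torsion₃_xi_xi {X : VField I M} (hX : IsSectionOf S.horizontal X) (i j : Fin 3) :
    torsion₃ cov X (S.xi i) (S.xi j)
      = -AlmostContact.metric (mlieBracket I (S.xi i) (S.xi j)) X := by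
  ext x
  have hi := (S.isSmoothVField_xi i).mdifferentiableAt x
  have hj := (S.isSmoothVField_xi j).mdifferentiableAt x
  have h := hc.skew x
  simp only [AlmostContact.metric, Pi.neg_apply, mlieBracket_eq_sub_torsion (cov := cov) hi hj,
    inner_sub_left, hc.inner_cov_of_mem (S.isSmoothVField_xi _) hX, torsion₃]
  linarith [(h (X x) (S.xi i x) (S.xi j x)).1, (h (S.xi i x) (X x) (S.xi j x)).2]

theorem lieDerivMetric_xi {X Y : VField I M} (hX : IsSectionOf S.horizontal X)
    (hY : IsSectionOf S.horizontal Y) (i : Fin 3) : lieDerivMetric (S.xi i) X Y = 0 := by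
  ext x
  have hi := S.isSmoothVField_xi i
  have h := hc.skew x
  simp only [lieDerivMetric, Pi.sub_apply, hc.dirDeriv_metric hi hX.1 hY.1]
  simp only [AlmostContact.metric,
    mlieBracket_eq_sub_torsion (cov := cov) (hi.mdifferentiableAt x) (hX.1.mdifferentiableAt x),
    mlieBracket_eq_sub_torsion (cov := cov) (hi.mdifferentiableAt x) (hY.1.mdifferentiableAt x),
    inner_sub_left, hc.inner_cov_of_mem hX.1 hY, Pi.zero_apply,
    real_inner_comm _ (X x), hc.inner_cov_of_mem hY.1 hX]
  linarith [(h (S.xi i x) (X x) (Y x)).2]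

theorem lieDerivMetric_xi_xi {X : VField I M} (hX : IsSectionOf S.horizontal X) (i j : Fin 3) :
    lieDerivMetric X (S.xi i) (S.xi j) = 0 := by
  ext x
  have hi := S.isSmoothVField_xi i
  have hj := S.isSmoothVField_xi j
  have h := hc.skew x
  simp only [lieDerivMetric, Pi.sub_apply, hc.dirDeriv_metric hX.1 hi hj]
  simp only [AlmostContact.metric,
    mlieBracket_eq_sub_torsion (cov := cov) (hX.1.mdifferentiableAt x) (hi.mdifferentiableAt x),
    mlieBracket_eq_sub_torsion (cov := cov) (hX.1.mdifferentiableAt x) (hj.mdifferentiableAt x),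
    inner_sub_left, hc.inner_cov_xi hi hX, Pi.zero_apply,
    real_inner_comm _ (S.xi i x), hc.inner_cov_xi hj hX]
  linarith [(h (X x) (S.xi i x) (S.xi j x)).2]

end IsCompatibleConnection

end Compatible

end AlmostContact

namespace AlmostContact

section Trilinear

variable {V : Type*} [NormedAddCommGroup V] [InnerProductSpace ℝ V]

/-- A real function of three vectors is linear in each variable. -/
structure IsTrilinear (t : V → V → V → ℝ) : Prop where
  left (v w : V) : IsLinearMap ℝ fun u ↦ t u v w
  middle (u w : V) : IsLinearMap ℝ fun v ↦ t u v w
  right (u v : V) : IsLinearMap ℝ fun w ↦ t u v w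

theorem IsTrilinear.add {t t' : V → V → V → ℝ} (h : IsTrilinear t) (h' : IsTrilinear t') :
    IsTrilinear fun u v w ↦ t u v w + t' u v w where
  left v w := ((h.left v w).mk' + (h'.left v w).mk').isLinear
  middle u w := ((h.middle u w).mk' + (h'.middle u w).mk').isLinear
  right u v := ((h.right u v).mk' + (h'.right u v).mk').isLinear

theorem IsTrilinear.rotate {t : V → V → V → ℝ} (h : IsTrilinear t) :
    IsTrilinear fun u v w ↦ t v w u where
  left v w := h.right v w
  middle u w := h.left w u
  right u v := h.middle v u

/-- The cyclic sum of a function of three vectors. -/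
def cyclicSum (t : V → V → V → ℝ) (u v w : V) : ℝ := t u v w + t v w u + t w u v

theorem IsTrilinear.cyclicSum {t : V → V → V → ℝ} (h : IsTrilinear t) :
    IsTrilinear (cyclicSum t) :=
  (h.add h.rotate).add h.rotate.rotate

theorem IsTrilinear.exists_clm [FiniteDimensional ℝ V] {t : V → V → V → ℝ} (h : IsTrilinear t) :
    ∃ A : V →L[ℝ] V →L[ℝ] V, ∀ u v w, inner ℝ (A v u) w = t u v w := by
  have : CompleteSpace V := FiniteDimensional.complete ℝ V
  let d (u v : V) : V := (InnerProductSpace.toDual ℝ V).symm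
    (LinearMap.toContinuousLinearMap (h.right u v).mk')
  have hd (u v w : V) : inner ℝ (d u v) w = t u v w := by simp [d]
  let B : V →ₗ[ℝ] V →ₗ[ℝ] V := LinearMap.mk₂ ℝ (fun v u ↦ d u v)
    (fun v v' u ↦ ext_inner_right ℝ fun w ↦ by
      simp only [inner_add_left, hd]; exact (h.middle u w).map_add v v')
    (fun c v u ↦ ext_inner_right ℝ fun w ↦ by
      simp only [inner_smul_left, hd]; exact (h.middle u w).map_smul c v)
    (fun v u u' ↦ ext_inner_right ℝ fun w ↦ by
      simp only [inner_add_left, hd]; exact (h.left v w).map_add u u')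
    (fun c v u ↦ ext_inner_right ℝ fun w ↦ by
      simp only [inner_smul_left, hd]; exact (h.left v w).map_smul c u)
  exact ⟨B.toContinuousBilinearMap, fun u v w ↦ hd u v w⟩

end Trilinear

variable {E : Type*} [NormedAddCommGroup E] [NormedSpace ℝ E] [FiniteDimensional ℝ E]
  [CompleteSpace E]
  {H : Type*} [TopologicalSpace H] {I : ModelWithCorners ℝ E H}
  {M : Type*} [TopologicalSpace M] [ChartedSpace H M] [IsManifold I ∞ M]
  [RiemannianBundle (fun x : M ↦ TangentSpace I x)]
  [IsContMDiffRiemannianBundle I ∞ E (fun x : M ↦ TangentSpace I x)]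

section Connection

theorem dirDeriv_of_forall_eq_zero {f : M → ℝ} (h : ∀ x, f x = 0) (X : VField I M) (x : M) :
    dirDeriv X f x = 0 := by
  rw [show f = 0 from funext h, dirDeriv, mvfderiv_zero]
  rfl

/-- Adding a field `A` with `g(A(Y)(X), Z)` totally skew-symmetric to the Levi-Civita connection
gives a metric connection. -/
theorem isMetricConnection_addOneForm
    {A : (x : M) → TangentSpace I x →L[ℝ] TangentSpace I x →L[ℝ] TangentSpace I x}
    (hA : ∀ x (u v w : TangentSpace I x), inner ℝ (A x w u) v = -inner ℝ (A x v u) w) :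
    IsMetricConnection ((leviCivita I M).addOneForm A) := by
  intro X Y Z hX hY hZ
  ext x
  rw [leviCivita_metric (hX.mdifferentiableAt x) (hY.mdifferentiableAt x)
    (hZ.mdifferentiableAt x)]
  have h := hA x (X x) (Y x) (Z x)
  simp only [metric, nabla, CovariantDerivative.addOneForm, Pi.add_apply, add_apply,
    inner_add_left, inner_add_right]
  rw [← real_inner_comm] at h
  linarith!

theorem addOneForm_apply (cov : CovariantDerivative I E (fun x : M ↦ TangentSpace I x))
    (A : (x : M) → TangentSpace I x →L[ℝ] TangentSpace I x →L[ℝ] TangentSpace I x)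
    (Y : VField I M) (x : M) (u : TangentSpace I x) :
    cov.addOneForm A Y x u = cov Y x u + A x (Y x) u :=
  rfl

theorem torsion_addOneForm
    (A : (x : M) → TangentSpace I x →L[ℝ] TangentSpace I x →L[ℝ] TangentSpace I x)
    (x : M) (u v : TangentSpace I x) :
    ((leviCivita I M).addOneForm A).torsion x u v = A x v u - A x u v := by
  have hu := FiberBundle.mdifferentiableAt_extend I E u
  have hv := FiberBundle.mdifferentiableAt_extend I E v
  have h := leviCivita_sub hu hv
  rw [CovariantDerivative.torsion_apply_eq_extend, ← h]
  simp only [addOneForm_apply, FiberBundle.extend_apply_self]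
  abel

end Connection

namespace ThreeContactMetric

variable {S : ThreeContactMetric I M} {s : Triple I M}

theorem IsHermitian.tensorialAt_leviCivita_phi (hs : S.IsHermitian s) (x : M) :
    TensorialAt I E (fun Y : VField I M ↦
      leviCivita I M (s.phi.app Y) x - (s.phi x) ∘L leviCivita I M Y x) x where
  smul {f Y} hf hY := by
    have h : s.phi.app (f • Y) = f • s.phi.app Y := by ext y; simp [EndField.app]
    rw [h, (leviCivita I M).isCovariantDerivativeOnUniv.leibniz hY hf,
      (leviCivita I M).isCovariantDerivativeOnUniv.leibniz (hs.mdifferentiableAt hY) hf]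
    ext v
    simp [EndField.app]
    module
  add {Y Y'} hY hY' := by
    have h : s.phi.app (Y + Y') = s.phi.app Y + s.phi.app Y' := by ext y; simp [EndField.app]
    rw [h, (leviCivita I M).isCovariantDerivativeOnUniv.add hY hY',
      (leviCivita I M).isCovariantDerivativeOnUniv.add (hs.mdifferentiableAt hY)
        (hs.mdifferentiableAt hY')]
    ext v
    simp
    abel

/-- The tensor field `g((∇_u φ) v, w)` of the Levi-Civita connection. -/
def IsHermitian.derivPhi (hs : S.IsHermitian s) (x : M) (u v w : TangentSpace I x) : ℝ :=
  inner ℝ (TensorialAt.mkHom _ x (hs.tensorialAt_leviCivita_phi x) v u) w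

variable (hs : S.IsHermitian s)

namespace IsHermitian

theorem derivPhi_apply {Y : VField I M} {x : M} (hY : MDiffAt (T% Y) x)
    (u w : TangentSpace I x) :
    hs.derivPhi x u (Y x) w
      = inner ℝ (leviCivita I M (s.phi.app Y) x u) w
        + inner ℝ (leviCivita I M Y x u) (s.phi x w) := by
  rw [derivPhi, TensorialAt.mkHom_apply _ hY]
  change inner ℝ (_ - s.phi x _) w = _
  rw [inner_sub_left, hs.inner_phi]
  exact sub_neg_eq_add _ _

theorem isTrilinear_derivPhi (x : M) : IsTrilinear (hs.derivPhi x) where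
  left v w := ⟨fun u u' ↦ by simp [derivPhi, inner_add_left],
    fun c u ↦ by simp [derivPhi, inner_smul_left]⟩
  middle u w := ⟨fun v v' ↦ by simp [derivPhi, inner_add_left],
    fun c v ↦ by simp [derivPhi, inner_smul_left]⟩
  right u v := ⟨fun w w' ↦ by simp [derivPhi, inner_add_right],
    fun c w ↦ by simp [derivPhi, inner_smul_right]⟩

theorem derivPhi_swap (x : M) (u v w : TangentSpace I x) :
    hs.derivPhi x u w v = -hs.derivPhi x u v w := by
  have hu := FiberBundle.mdifferentiableAt_extend I E u
  have hv := FiberBundle.mdifferentiableAt_extend I E v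
  have hw := FiberBundle.mdifferentiableAt_extend I E w
  have h1 := hs.derivPhi_apply hv u w
  have h2 := hs.derivPhi_apply hw u v
  rw [FiberBundle.extend_apply_self] at h1 h2
  have h3 := leviCivita_metric hu (hs.mdifferentiableAt hv) hw
  have h4 := leviCivita_metric hu hv (hs.mdifferentiableAt hw)
  have h5 : metric (s.phi.app (FiberBundle.extend E v)) (FiberBundle.extend E w)
      = -metric (FiberBundle.extend E v) (s.phi.app (FiberBundle.extend E w)) :=
    funext fun y ↦ hs.inner_phi y _ _
  rw [h5, dirDeriv, mvfderiv_neg, neg_apply] at h3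
  rw [dirDeriv] at h4
  simp only [FiberBundle.extend_apply_self, EndField.app] at h1 h2 h3 h4
  rw [h1, h2]
  have h6 := real_inner_comm v (leviCivita I M (s.phi.app (FiberBundle.extend E w)) x u)
  have h7 := real_inner_comm (s.phi x v) (leviCivita I M (FiberBundle.extend E w) x u)
  linarith

theorem derivPhi_phi [T2Space M] {x : M} (u : TangentSpace I x) {v w : TangentSpace I x}
    (hv : v ∈ S.horizontal x) (hw : w ∈ S.horizontal x) :
    hs.derivPhi x u (s.phi x v) w = hs.derivPhi x u v (s.phi x w) := by
  obtain ⟨Y, hY, rfl⟩ := S.exists_isSectionOf_horizontal hv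
  have hYx := hY.1.mdifferentiableAt x
  have h1 := hs.derivPhi_apply (hs.mdifferentiableAt hYx) u w
  have h2 := hs.derivPhi_apply hYx u (s.phi x w)
  have h3 : s.phi.app (s.phi.app Y) = (-1 : ℝ) • Y := funext fun y ↦ by
    rw [hs.phi_app_phi_app hY]; simp
  rw [h3, (leviCivita I M).isCovariantDerivativeOnUniv.smul_const (-1) hYx] at h1
  rw [h2, hs.phi_phi hw]
  refine h1.trans ?_
  simp only [smul_apply, inner_smul_left, inner_neg_right]
  simp
  ring

theorem derivPhi_phi_phi [T2Space M] {x : M} (u : TangentSpace I x) {v w : TangentSpace I x}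
    (hv : v ∈ S.horizontal x) (hw : w ∈ S.horizontal x) :
    hs.derivPhi x u (s.phi x v) (s.phi x w) = -hs.derivPhi x u v w := by
  rw [hs.derivPhi_phi u hv (hs.phi_mem hw), hs.phi_phi hw]
  exact ((hs.isTrilinear_derivPhi x).right u v).map_neg w

theorem derivPhi_neg_left (x : M) (u v w : TangentSpace I x) :
    hs.derivPhi x (-u) v w = -hs.derivPhi x u v w :=
  ((hs.isTrilinear_derivPhi x).left v w).map_neg u

theorem nijenhuis₃_eq_derivPhi {X Y Z : VField I M} (hX : IsSectionOf S.horizontal X)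
    (hY : IsSectionOf S.horizontal Y) (hZ : IsSectionOf S.horizontal Z) (x : M) :
    s.nijenhuis₃ X Y Z x
      = hs.derivPhi x (s.phi x (X x)) (Y x) (Z x) - hs.derivPhi x (s.phi x (Y x)) (X x) (Z x)
        + hs.derivPhi x (X x) (Y x) (s.phi x (Z x))
        - hs.derivPhi x (Y x) (X x) (s.phi x (Z x)) := by
  have hXx := hX.1.mdifferentiableAt x
  have hYx := hY.1.mdifferentiableAt x
  have hX' := hs.mdifferentiableAt hXx
  have hY' := hs.mdifferentiableAt hYx
  rw [hs.nijenhuis₃_apply hZ, ← leviCivita_sub hXx hYx, ← leviCivita_sub hX' hYx,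
    ← leviCivita_sub hXx hY', ← leviCivita_sub hX' hY',
    hs.derivPhi_apply hYx, hs.derivPhi_apply hYx, hs.derivPhi_apply hXx, hs.derivPhi_apply hXx]
  simp only [EndField.app, inner_sub_left, hs.phi_phi (hZ.2 x), inner_neg_right]
  ring

theorem derivPhi_of_nijenhuisSkewOn [T2Space M] (h : s.NijenhuisSkewOn S.horizontal) {x : M}
    {u v w : TangentSpace I x} (hu : u ∈ S.horizontal x) (hv : v ∈ S.horizontal x)
    (hw : w ∈ S.horizontal x) :
    hs.derivPhi x (s.phi x v) u w + hs.derivPhi x (s.phi x w) u v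
      + hs.derivPhi x v u (s.phi x w) + hs.derivPhi x w u (s.phi x v) = 0 := by
  obtain ⟨X, hX, rfl⟩ := S.exists_isSectionOf_horizontal hu
  obtain ⟨Y, hY, rfl⟩ := S.exists_isSectionOf_horizontal hv
  obtain ⟨Z, hZ, rfl⟩ := S.exists_isSectionOf_horizontal hw
  have h1 := congrFun (h X Y Z hX hY hZ).2 x
  rw [Pi.neg_apply, hs.nijenhuis₃_eq_derivPhi hX hY hZ, hs.nijenhuis₃_eq_derivPhi hX hZ hY] at h1
  have h2 := hs.derivPhi_swap x (s.phi x (X x)) (Y x) (Z x)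
  have h3 := hs.derivPhi_swap x (X x) (Y x) (s.phi x (Z x))
  have h4 := hs.derivPhi_phi (X x) hw hv
  linarith

end IsHermitian

end ThreeContactMetric

end AlmostContact

namespace AlmostContact

variable {E : Type*} [NormedAddCommGroup E] [NormedSpace ℝ E] [FiniteDimensional ℝ E]
  [CompleteSpace E]
  {H : Type*} [TopologicalSpace H] {I : ModelWithCorners ℝ E H}
  {M : Type*} [TopologicalSpace M] [ChartedSpace H M] [IsManifold I ∞ M]
  [RiemannianBundle (fun x : M ↦ TangentSpace I x)]
  [IsContMDiffRiemannianBundle I ∞ E (fun x : M ↦ TangentSpace I x)]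

namespace ThreeContactMetric

section Vertical

variable (S : ThreeContactMetric I M)

/-- The bilinear form `g(∇_u ξ_i, v)` of the Levi-Civita connection. -/
def derivXi (i : Fin 3) (x : M) (u v : TangentSpace I x) : ℝ :=
  inner ℝ (leviCivita I M (S.xi i) x u) v

theorem derivXi_add_left (i : Fin 3) (x : M) (u u' v : TangentSpace I x) :
    S.derivXi i x (u + u') v = S.derivXi i x u v + S.derivXi i x u' v := by
  simp [derivXi, inner_add_left]

theorem derivXi_smul_left (i : Fin 3) (x : M) (c : ℝ) (u v : TangentSpace I x) :
    S.derivXi i x (c • u) v = c * S.derivXi i x u v := by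
  simp [derivXi, inner_smul_left]

theorem derivXi_add_right (i : Fin 3) (x : M) (u v v' : TangentSpace I x) :
    S.derivXi i x u (v + v') = S.derivXi i x u v + S.derivXi i x u v' :=
  inner_add_right _ _ _

theorem derivXi_smul_right (i : Fin 3) (x : M) (c : ℝ) (u v : TangentSpace I x) :
    S.derivXi i x u (c • v) = c * S.derivXi i x u v :=
  inner_smul_right _ _ _

theorem derivXi_zero_left (i : Fin 3) (x : M) (v : TangentSpace I x) :
    S.derivXi i x 0 v = 0 := by
  simp [derivXi]

theorem derivXi_zero_right (i : Fin 3) (x : M) (u : TangentSpace I x) :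
    S.derivXi i x u 0 = 0 :=
  inner_zero_right _

theorem inner_leviCivita_xi {Y : VField I M} (hY : IsSectionOf S.horizontal Y) (i : Fin 3) (x : M)
    (u : TangentSpace I x) :
    inner ℝ (leviCivita I M Y x u) (S.xi i x) = -S.derivXi i x u (Y x) := by
  have hu := FiberBundle.mdifferentiableAt_extend I E u
  have h := leviCivita_metric hu (hY.1.mdifferentiableAt x)
    ((S.isSmoothVField_xi i).mdifferentiableAt x)
  rw [dirDeriv_of_forall_eq_zero (f := metric Y (S.xi i)) fun y ↦ S.inner_xi_of_mem i (hY.2 y),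
    FiberBundle.extend_apply_self] at h
  have h' := real_inner_comm (Y x) (leviCivita I M (S.xi i) x u)
  rw [derivXi]
  linarith

theorem derivXi_swap [T2Space M]
    (h : ∀ (i : Fin 3) (X Y : VField I M), IsSectionOf S.horizontal X →
      IsSectionOf S.horizontal Y → lieDerivMetric (S.xi i) X Y = 0) (i : Fin 3)
    {x : M} {u v : TangentSpace I x} (hu : u ∈ S.horizontal x) (hv : v ∈ S.horizontal x) :
    S.derivXi i x v u = -S.derivXi i x u v := by
  obtain ⟨X, hX, rfl⟩ := S.exists_isSectionOf_horizontal hu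
  obtain ⟨Y, hY, rfl⟩ := S.exists_isSectionOf_horizontal hv
  have hXx := hX.1.mdifferentiableAt x
  have hYx := hY.1.mdifferentiableAt x
  have hξ := (S.isSmoothVField_xi i).mdifferentiableAt x
  have h1 := congrFun (h i X Y hX hY) x
  simp only [lieDerivMetric, Pi.sub_apply, leviCivita_metric hξ hXx hYx] at h1
  simp only [metric, ← leviCivita_sub hξ hXx, ← leviCivita_sub hξ hYx, inner_sub_left,
    Pi.zero_apply, real_inner_comm _ (X x)] at h1
  rw [derivXi, derivXi]
  linarith

theorem derivXi_xi_swap [T2Space M]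
    (h : ∀ (i j : Fin 3) (X : VField I M), IsSectionOf S.horizontal X →
      lieDerivMetric X (S.xi i) (S.xi j) = 0) (i j : Fin 3)
    {x : M} {u : TangentSpace I x} (hu : u ∈ S.horizontal x) :
    S.derivXi i x (S.xi j x) u = -S.derivXi j x (S.xi i x) u := by
  obtain ⟨X, hX, rfl⟩ := S.exists_isSectionOf_horizontal hu
  have hXx := hX.1.mdifferentiableAt x
  have hi := (S.isSmoothVField_xi i).mdifferentiableAt x
  have hj := (S.isSmoothVField_xi j).mdifferentiableAt x
  have h1 := congrFun (h i j X hX) x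
  have h2 := S.inner_leviCivita_xi hX j x (S.xi i x)
  have h3 := S.inner_leviCivita_xi hX i x (S.xi j x)
  simp only [lieDerivMetric, Pi.sub_apply, leviCivita_metric hXx hi hj] at h1
  simp only [metric, ← leviCivita_sub hXx hi, ← leviCivita_sub hXx hj, inner_sub_left,
    Pi.zero_apply, real_inner_comm _ (S.xi i x)] at h1
  linarith

/-- The tensor field `∑ i, g(∇_{Pu} ξ_i, Pv) η_i(w)`, where `P` is the horizontal projection. -/
def mixedForm (x : M) (u v w : TangentSpace I x) : ℝ :=
  ∑ i, S.derivXi i x (S.proj x u) (S.proj x v) * S.eta i x w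

/-- The tensor field `-∑ i j, g(∇_{ξ_i} ξ_j, Pu) η_i(v) η_j(w)`. -/
def verticalForm (x : M) (u v w : TangentSpace I x) : ℝ :=
  -∑ i, ∑ j, S.derivXi j x (S.xi i x) (S.proj x u) * (S.eta i x v * S.eta j x w)

theorem isTrilinear_mixedForm (x : M) : IsTrilinear (S.mixedForm x) where
  left v w := ⟨fun u u' ↦ by
      simp only [mixedForm, map_add, derivXi_add_left, add_mul, Finset.sum_add_distrib],
    fun c u ↦ by
      simp only [mixedForm, map_smul, derivXi_smul_left, mul_assoc, ← Finset.mul_sum, smul_eq_mul]⟩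
  middle u w := ⟨fun u u' ↦ by
      simp only [mixedForm, map_add, derivXi_add_right, add_mul, Finset.sum_add_distrib],
    fun c u ↦ by
      simp only [mixedForm, map_smul, derivXi_smul_right, mul_assoc, ← Finset.mul_sum,
        smul_eq_mul]⟩
  right u v := ⟨fun w w' ↦ by
      simp only [mixedForm, map_add, mul_add, Finset.sum_add_distrib],
    fun c w ↦ by
      simp only [mixedForm, map_smul, smul_eq_mul, mul_left_comm, ← Finset.mul_sum]⟩

theorem isTrilinear_verticalForm (x : M) : IsTrilinear (S.verticalForm x) where
  left v w := ⟨fun u u' ↦ by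
      simp only [verticalForm, map_add, derivXi_add_right, add_mul, Finset.sum_add_distrib,
        neg_add],
    fun c u ↦ by
      simp only [verticalForm, map_smul, derivXi_smul_right, mul_assoc, ← Finset.mul_sum,
        smul_eq_mul, mul_neg]⟩
  middle u w := ⟨fun v v' ↦ by
      simp only [verticalForm, map_add, add_mul, mul_add, Finset.sum_add_distrib, neg_add],
    fun c v ↦ by
      simp only [verticalForm, map_smul, smul_eq_mul, mul_left_comm _ c, mul_assoc c,
        ← Finset.mul_sum, mul_neg]⟩
  right u v := ⟨fun w w' ↦ by
      simp only [verticalForm, map_add, mul_add, Finset.sum_add_distrib, neg_add],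
    fun c w ↦ by
      simp only [verticalForm, map_smul, smul_eq_mul, mul_left_comm _ c, ← Finset.mul_sum,
        mul_neg]⟩

theorem mixedForm_swap [T2Space M]
    (h : ∀ (i : Fin 3) (X Y : VField I M), IsSectionOf S.horizontal X →
      IsSectionOf S.horizontal Y → lieDerivMetric (S.xi i) X Y = 0)
    (x : M) (u v w : TangentSpace I x) : S.mixedForm x v u w = -S.mixedForm x u v w := by
  simp only [mixedForm, S.derivXi_swap h _ (S.proj_mem x u) (S.proj_mem x v), neg_mul,
    Finset.sum_neg_distrib]

theorem verticalForm_swap [T2Space M]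
    (h : ∀ (i j : Fin 3) (X : VField I M), IsSectionOf S.horizontal X →
      lieDerivMetric X (S.xi i) (S.xi j) = 0)
    (x : M) (u v w : TangentSpace I x) : S.verticalForm x u w v = -S.verticalForm x u v w := by
  simp only [verticalForm, ← Finset.sum_neg_distrib]
  rw [Finset.sum_comm]
  refine Finset.sum_congr rfl fun i _ ↦ Finset.sum_congr rfl fun j _ ↦ ?_
  rw [S.derivXi_xi_swap h i j (S.proj_mem x u)]
  ring

theorem eta_eq_metric (i : Fin 3) (X : VField I M) (x : M) :
    S.eta i x (X x) = metric X (S.xi i) x :=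
  (S.inner_xi i x (X x)).symm

theorem contMDiff_derivXi [T2Space M] (i : Fin 3) {X Y : VField I M} (hX : IsSmoothVField X)
    (hY : IsSmoothVField Y) : ContMDiff I 𝓘(ℝ, ℝ) ∞ fun x ↦ S.derivXi i x (X x) (Y x) :=
  (IsSmoothVField.nabla contMDiffCovariantDerivative_leviCivita hX
    (S.isSmoothVField_xi i)).contMDiff_metric hY

theorem contMDiff_eta (i : Fin 3) {X : VField I M} (hX : IsSmoothVField X) :
    ContMDiff I 𝓘(ℝ, ℝ) ∞ fun x ↦ S.eta i x (X x) := by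
  simp only [S.eta_eq_metric]
  exact hX.contMDiff_metric (S.isSmoothVField_xi i)

theorem contMDiff_mixedForm [T2Space M] {X Y Z : VField I M} (hX : IsSmoothVField X)
    (hY : IsSmoothVField Y) (hZ : IsSmoothVField Z) :
    ContMDiff I 𝓘(ℝ, ℝ) ∞ fun x ↦ S.mixedForm x (X x) (Y x) (Z x) :=
  contMDiff_finsetSum fun i _ ↦ (S.contMDiff_derivXi i (S.isSmoothVField_proj hX)
    (S.isSmoothVField_proj hY)).mul (S.contMDiff_eta i hZ)

theorem contMDiff_verticalForm [T2Space M] {X Y Z : VField I M} (hX : IsSmoothVField X)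
    (hY : IsSmoothVField Y) (hZ : IsSmoothVField Z) :
    ContMDiff I 𝓘(ℝ, ℝ) ∞ fun x ↦ S.verticalForm x (X x) (Y x) (Z x) :=
  (contMDiff_finsetSum fun i _ ↦ contMDiff_finsetSum fun j _ ↦
    (S.contMDiff_derivXi j (S.isSmoothVField_xi i) (S.isSmoothVField_proj hX)).mul
      ((S.contMDiff_eta i hY).mul (S.contMDiff_eta j hZ))).neg

end Vertical

namespace IsHermitian

variable {S : ThreeContactMetric I M} {s : Triple I M} (hs : S.IsHermitian s)

/-- Half the horizontal part of the torsion of a compatible connection. -/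
def horizontalForm (x : M) (u v w : TangentSpace I x) : ℝ :=
  (hs.derivPhi x (S.proj x u) (S.proj x v) (s.phi x (S.proj x w))
    - hs.derivPhi x (S.proj x v) (S.proj x u) (s.phi x (S.proj x w))
    - hs.derivPhi x (s.phi x (S.proj x w)) (S.proj x u) (S.proj x v)) / 2

theorem isTrilinear_horizontalForm (x : M) : IsTrilinear (hs.horizontalForm x) where
  left v w := ⟨fun u u' ↦ by
      simp only [horizontalForm, map_add, ((hs.isTrilinear_derivPhi x).left _ _).map_add,
        ((hs.isTrilinear_derivPhi x).middle _ _).map_add]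
      ring,
    fun c u ↦ by
      simp only [horizontalForm, map_smul, ((hs.isTrilinear_derivPhi x).left _ _).map_smul,
        ((hs.isTrilinear_derivPhi x).middle _ _).map_smul, smul_eq_mul]
      ring⟩
  middle u w := ⟨fun v v' ↦ by
      simp only [horizontalForm, map_add, ((hs.isTrilinear_derivPhi x).left _ _).map_add,
        ((hs.isTrilinear_derivPhi x).middle _ _).map_add,
        ((hs.isTrilinear_derivPhi x).right _ _).map_add]
      ring,
    fun c u ↦ by
      simp only [horizontalForm, map_smul, ((hs.isTrilinear_derivPhi x).left _ _).map_smul,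
        ((hs.isTrilinear_derivPhi x).middle _ _).map_smul,
        ((hs.isTrilinear_derivPhi x).right _ _).map_smul, smul_eq_mul]
      ring⟩
  right u v := ⟨fun v v' ↦ by
      simp only [horizontalForm, map_add, ((hs.isTrilinear_derivPhi x).left _ _).map_add,
        ((hs.isTrilinear_derivPhi x).right _ _).map_add]
      ring,
    fun c u ↦ by
      simp only [horizontalForm, map_smul, ((hs.isTrilinear_derivPhi x).left _ _).map_smul,
        ((hs.isTrilinear_derivPhi x).right _ _).map_smul, smul_eq_mul]
      ring⟩

theorem horizontalForm_swap_left (x : M) (u v w : TangentSpace I x) :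
    hs.horizontalForm x v u w = -hs.horizontalForm x u v w := by
  simp only [horizontalForm, hs.derivPhi_swap x _ (S.proj x u) (S.proj x v)]
  ring

theorem horizontalForm_swap_right [T2Space M] (h : s.NijenhuisSkewOn S.horizontal) (x : M)
    (u v w : TangentSpace I x) :
    hs.horizontalForm x u w v = -hs.horizontalForm x u v w := by
  have hu := S.proj_mem x u
  have hv := S.proj_mem x v
  have hw := S.proj_mem x w
  have h1 := hs.derivPhi_of_nijenhuisSkewOn h hu hv hw
  have h2 := hs.derivPhi_phi (S.proj x u) hv hw
  have h3 := hs.derivPhi_swap x (S.proj x u) (s.phi x (S.proj x v)) (S.proj x w)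
  simp only [horizontalForm]
  linarith

theorem derivPhi_add_horizontalForm [T2Space M] (h : s.NijenhuisSkewOn S.horizontal) {x : M}
    {u v w : TangentSpace I x} (hu : u ∈ S.horizontal x) (hv : v ∈ S.horizontal x)
    (hw : w ∈ S.horizontal x) :
    hs.derivPhi x u v w + hs.horizontalForm x u (s.phi x v) w
      + hs.horizontalForm x u v (s.phi x w) = 0 := by
  have h1 := hs.derivPhi_of_nijenhuisSkewOn h hu (hs.phi_mem hv) hw
  simp only [horizontalForm, S.proj_eq_self hu, S.proj_eq_self hv, S.proj_eq_self hw,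
    S.proj_eq_self (hs.phi_mem hv), S.proj_eq_self (hs.phi_mem hw)]
  simp only [hs.phi_phi hv, hs.phi_phi hw, hs.derivPhi_neg_left,
    hs.derivPhi_phi_phi _ hv hw, ((hs.isTrilinear_derivPhi x).right _ _).map_neg] at h1 ⊢
  linarith

theorem contMDiff_derivPhi [T2Space M] {X Y Z : VField I M} (hX : IsSmoothVField X)
    (hY : IsSmoothVField Y) (hZ : IsSmoothVField Z) :
    ContMDiff I 𝓘(ℝ, ℝ) ∞ fun x ↦ hs.derivPhi x (X x) (Y x) (Z x) := by
  have h : (fun x ↦ hs.derivPhi x (X x) (Y x) (Z x))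
      = metric (nabla (leviCivita I M) X (s.phi.app Y)) Z
        + metric (nabla (leviCivita I M) X Y) (s.phi.app Z) :=
    funext fun x ↦ hs.derivPhi_apply (hY.mdifferentiableAt x) _ _
  rw [h]
  exact ((IsSmoothVField.nabla contMDiffCovariantDerivative_leviCivita hX
    (hs.isSmoothVField hY)).contMDiff_metric hZ).add
    ((IsSmoothVField.nabla contMDiffCovariantDerivative_leviCivita hX hY).contMDiff_metric
      (hs.isSmoothVField hZ))

theorem contMDiff_horizontalForm [T2Space M] {X Y Z : VField I M} (hX : IsSmoothVField X)
    (hY : IsSmoothVField Y) (hZ : IsSmoothVField Z) :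
    ContMDiff I 𝓘(ℝ, ℝ) ∞ fun x ↦ hs.horizontalForm x (X x) (Y x) (Z x) := by
  have hX' := S.isSmoothVField_proj hX
  have hY' := S.isSmoothVField_proj hY
  have hZ' := hs.isSmoothVField (S.isSmoothVField_proj hZ)
  exact (((hs.contMDiff_derivPhi hX' hY' hZ').sub (hs.contMDiff_derivPhi hY' hX' hZ')).sub
    (hs.contMDiff_derivPhi hZ' hX' hY')).div_const 2

/-- Half the torsion of a compatible connection. -/
def halfTorsion (x : M) (u v w : TangentSpace I x) : ℝ :=
  hs.horizontalForm x u v w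
    + (cyclicSum (S.mixedForm x) u v w + cyclicSum (S.verticalForm x) u v w)

theorem isTrilinear_halfTorsion (x : M) : IsTrilinear (hs.halfTorsion x) :=
  (hs.isTrilinear_horizontalForm x).add
    ((S.isTrilinear_mixedForm x).cyclicSum.add (S.isTrilinear_verticalForm x).cyclicSum)

theorem contMDiff_halfTorsion [T2Space M] {X Y Z : VField I M} (hX : IsSmoothVField X)
    (hY : IsSmoothVField Y) (hZ : IsSmoothVField Z) :
    ContMDiff I 𝓘(ℝ, ℝ) ∞ fun x ↦ hs.halfTorsion x (X x) (Y x) (Z x) :=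
  (hs.contMDiff_horizontalForm hX hY hZ).add
    ((((S.contMDiff_mixedForm hX hY hZ).add (S.contMDiff_mixedForm hY hZ hX)).add
      (S.contMDiff_mixedForm hZ hX hY)).add
    (((S.contMDiff_verticalForm hX hY hZ).add (S.contMDiff_verticalForm hY hZ hX)).add
      (S.contMDiff_verticalForm hZ hX hY)))

theorem halfTorsion_of_mem {x : M} {u v w : TangentSpace I x}
    (hu : u ∈ S.horizontal x) (hv : v ∈ S.horizontal x) (hw : w ∈ S.horizontal x) :
    hs.halfTorsion x u v w = hs.horizontalForm x u v w := by
  simp [halfTorsion, cyclicSum, mixedForm, verticalForm, S.mem_horizontal.mp hu,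
    S.mem_horizontal.mp hv, S.mem_horizontal.mp hw]

theorem halfTorsion_xi [T2Space M]
    (h : ∀ (i j : Fin 3) (X : VField I M), IsSectionOf S.horizontal X →
      lieDerivMetric X (S.xi i) (S.xi j) = 0) {x : M} (u : TangentSpace I x)
    {v : TangentSpace I x} (hv : v ∈ S.horizontal x) (i : Fin 3) :
    hs.halfTorsion x u v (S.xi i x) = S.derivXi i x u v := by
  have hu : u = S.proj x u + ∑ j, S.eta j x u • S.xi j x := by rw [proj_apply]; abel
  have h1 : S.derivXi i x u v = S.derivXi i x (S.proj x u) v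
      + ∑ j, S.eta j x u * S.derivXi i x (S.xi j x) v := by
    conv_lhs => rw [hu]
    rw [derivXi_add_left]
    simp [derivXi, sum_inner, inner_smul_left]
  have hF := hs.isTrilinear_derivPhi x
  have h3 : hs.horizontalForm x u v (S.xi i x) = 0 := by
    simp [horizontalForm, S.proj_xi, (hF.right _ _).map_zero, (hF.left _ _).map_zero]
  rw [h1, halfTorsion, h3]
  simp [cyclicSum, mixedForm, verticalForm, S.proj_xi, S.proj_eq_self hv, S.mem_horizontal.mp hv,
    eta_xi, derivXi_zero_left, derivXi_zero_right, S.derivXi_xi_swap h i _ hv, mul_comm]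

variable [T2Space M] (h₁ : s.NijenhuisSkewOn S.horizontal)
  (h₂ : ∀ (i : Fin 3) (X Y : VField I M), IsSectionOf S.horizontal X →
      IsSectionOf S.horizontal Y → lieDerivMetric (S.xi i) X Y = 0)
  (h₃ : ∀ (i j : Fin 3) (X : VField I M), IsSectionOf S.horizontal X →
      lieDerivMetric X (S.xi i) (S.xi j) = 0)
include h₁ h₂ h₃

theorem halfTorsion_swap_left (x : M) (u v w : TangentSpace I x) :
    hs.halfTorsion x v u w = -hs.halfTorsion x u v w := by
  have a := S.mixedForm_swap h₂ x
  have b := S.verticalForm_swap h₃ x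
  simp only [halfTorsion, cyclicSum]
  linarith [hs.horizontalForm_swap_left x u v w, a u v w, a v w u, a w u v, b u v w, b v w u,
    b w u v]

theorem halfTorsion_swap_right (x : M) (u v w : TangentSpace I x) :
    hs.halfTorsion x u w v = -hs.halfTorsion x u v w := by
  have a := S.mixedForm_swap h₂ x
  have b := S.verticalForm_swap h₃ x
  simp only [halfTorsion, cyclicSum]
  linarith [hs.horizontalForm_swap_right h₁ x u v w, a u v w, a v w u, a w u v, b u v w, b v w u,
    b w u v]

include hs in
theorem exists_isCompatibleConnection : ∃ cov, IsCompatibleConnection S s cov := by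
  have hfin (x : M) : FiniteDimensional ℝ (TangentSpace I x) :=
    inferInstanceAs (FiniteDimensional ℝ E)
  choose A hA using fun x ↦ (hs.isTrilinear_halfTorsion x).exists_clm
  have hcov (Y : VField I M) (x : M) (u w : TangentSpace I x) :
      inner ℝ ((leviCivita I M).addOneForm A Y x u) w
        = inner ℝ (leviCivita I M Y x u) w + hs.halfTorsion x u (Y x) w := by
    rw [addOneForm_apply, ← hA, ← inner_add_left]
  have hl := hs.halfTorsion_swap_left h₁ h₂ h₃
  have hr := hs.halfTorsion_swap_right h₁ h₂ h₃
  have hsmooth : CovariantDerivative.ContMDiffCovariantDerivative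
      ((leviCivita I M).addOneForm A) ∞ :=
    contMDiffCovariantDerivative_of_metric fun X Y Z hX hY hZ ↦ by
      have h : metric (nabla ((leviCivita I M).addOneForm A) X Y) Z
          = metric (nabla (leviCivita I M) X Y) Z
            + fun x ↦ hs.halfTorsion x (X x) (Y x) (Z x) := funext fun x ↦ hcov Y x _ _
      rw [h]
      exact ((IsSmoothVField.nabla contMDiffCovariantDerivative_leviCivita hX hY).contMDiff_metric
        hZ).add (hs.contMDiff_halfTorsion hX hY hZ)
  have hmetric : IsMetricConnection ((leviCivita I M).addOneForm A) :=
    isMetricConnection_addOneForm fun x u v w ↦ by rw [hA, hA, hr]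
  have hhor : Preserves ((leviCivita I M).addOneForm A) S.horizontal := fun X Y hX hY ↦
    ⟨IsSmoothVField.nabla hsmooth hX hY.1, fun x ↦ by
      rw [S.mem_horizontal]
      intro i
      rw [← S.inner_xi, nabla, hcov, S.inner_leviCivita_xi hY, hs.halfTorsion_xi h₃ _ (hY.2 x)]
      ring⟩
  refine ⟨(leviCivita I M).addOneForm A, hsmooth, hmetric, ?_, hhor, ?_, ?_⟩
  · intro x u v w
    simp only [torsion_addOneForm, inner_sub_left, hA]
    constructor
    · linarith [hl x u v w]
    · linarith [hl x u v w, hl x u w v, hr x u v w, hr x v u w, hr x w u v, hl x v w u]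
  · intro X W hX hW
    refine ⟨IsSmoothVField.nabla hsmooth hX hW.1, fun x ↦
      S.mem_vertical_of_inner_eq_zero fun w hw ↦ ?_⟩
    obtain ⟨Z, hZ, rfl⟩ := S.exists_isSectionOf_horizontal hw
    have h := congrFun (hmetric X W Z hX hW.1 hZ.1) x
    rw [dirDeriv_of_forall_eq_zero (f := metric W Z) fun y ↦
      S.inner_eq_zero_of_mem (hW.2 y) (hZ.2 y)] at h
    have h' := S.inner_eq_zero_of_mem (hW.2 x) ((hhor X Z hX hZ).2 x)
    rw [Pi.add_apply, metric, metric, h', add_zero] at h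
    exact h.symm
  · intro X Y hX hY
    ext x
    have hm : (nabla ((leviCivita I M).addOneForm A) X (s.phi.app Y)
        - s.phi.app (nabla ((leviCivita I M).addOneForm A) X Y)) x ∈ S.horizontal x :=
      Submodule.sub_mem _ ((hhor X _ hX.1 (hs.isSectionOf hY)).2 x)
        (hs.phi_mem ((hhor X Y hX.1 hY).2 x))
    refine inner_self_eq_zero (𝕜 := ℝ).mp ?_
    generalize hw : (nabla ((leviCivita I M).addOneForm A) X (s.phi.app Y)
        - s.phi.app (nabla ((leviCivita I M).addOneForm A) X Y)) x = w at hm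
    have h1 := hs.derivPhi_add_horizontalForm h₁ (hX.2 x) (hY.2 x) hm
    rw [hs.derivPhi_apply (hY.1.mdifferentiableAt x),
      ← hs.halfTorsion_of_mem (hX.2 x) (hs.phi_mem (hY.2 x)) hm,
      ← hs.halfTorsion_of_mem (hX.2 x) (hY.2 x) (hs.phi_mem hm)] at h1
    have h2 := hcov (s.phi.app Y) x (X x) w
    have h3 := hcov Y x (X x) (s.phi x w)
    conv_lhs => arg 2; rw [← hw]
    rw [Pi.sub_apply, inner_sub_left, nabla, EndField.app, hs.inner_phi, nabla, h2, h3]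
    rw [EndField.app]
    linarith

end IsHermitian

end ThreeContactMetric

end AlmostContact

end

theorem mainTheorem5 (n : ℕ)
    (M : Type*) [TopologicalSpace M] [T2Space M] [SecondCountableTopology M]
    [ChartedSpace (EuclideanSpace ℝ (Fin (4 * n + 3))) M] [IsManifold (𝓡 (4 * n + 3)) ∞ M]
    [RiemannianBundle (fun x : M ↦ TangentSpace (𝓡 (4 * n + 3)) x)]
    [IsContMDiffRiemannianBundle (𝓡 (4 * n + 3)) ∞ (EuclideanSpace ℝ (Fin (4 * n + 3)))
      (fun x : M ↦ TangentSpace (𝓡 (4 * n + 3)) x)]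
    (S : AlmostContact.ThreeContactMetric (𝓡 (4 * n + 3)) M)
    (s : AlmostContact.Triple (𝓡 (4 * n + 3)) M) (hs : s ∈ S.associatedSphere) :
    ((∃ cov, AlmostContact.IsCompatibleConnection S s cov) ↔
      s.NijenhuisSkewOn S.horizontal ∧
      (∀ (i : Fin 3) (X Y : AlmostContact.VField (𝓡 (4 * n + 3)) M),
        AlmostContact.IsSectionOf S.horizontal X → AlmostContact.IsSectionOf S.horizontal Y →
        AlmostContact.lieDerivMetric (S.xi i) X Y = 0) ∧
      (∀ (i j : Fin 3) (X : AlmostContact.VField (𝓡 (4 * n + 3)) M),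
        AlmostContact.IsSectionOf S.horizontal X →
        AlmostContact.lieDerivMetric X (S.xi i) (S.xi j) = 0)) ∧
    (∀ cov, AlmostContact.IsCompatibleConnection S s cov →
      ∀ X Y Z : AlmostContact.VField (𝓡 (4 * n + 3)) M,
        AlmostContact.IsSectionOf S.horizontal X → AlmostContact.IsSectionOf S.horizontal Y →
        AlmostContact.IsSectionOf S.horizontal Z →
        AlmostContact.torsion₃ cov X Y Z
          = s.nijenhuis₃ X Y Z
            - AlmostContact.extDerivTwo s.fundamentalForm
                (s.phi.app X) (s.phi.app Y) (s.phi.app Z) ∧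
        (∀ i : Fin 3, AlmostContact.torsion₃ cov X Y (S.xi i)
          = AlmostContact.extDerivOne (S.eta i) X Y) ∧
        (∀ i j : Fin 3, AlmostContact.torsion₃ cov X (S.xi i) (S.xi j)
          = -AlmostContact.metric (mlieBracket (𝓡 (4 * n + 3)) (S.xi i) (S.xi j)) X)) := by
  have hS := S.isHermitian_of_mem hs
  refine ⟨⟨?_, fun ⟨h₁, h₂, h₃⟩ ↦ hS.exists_isCompatibleConnection h₁ h₂ h₃⟩,
    fun cov hc X Y Z hX hY hZ ↦ ⟨hc.torsion₃_horizontal hS hX hY hZ,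
      fun i ↦ hc.torsion₃_xi hX hY i, fun i j ↦ hc.torsion₃_xi_xi hX i j⟩⟩
  rintro ⟨cov, hc⟩
  exact ⟨hc.nijenhuisSkewOn hS, fun i X Y hX hY ↦ hc.lieDerivMetric_xi hX hY i,
    fun i j X hX ↦ hc.lieDerivMetric_xi_xi hX i j⟩
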